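/- Let $\kappa=(\kappa_1,\kappa_2,\kappa_3)\in\mathbb R^3$ with all $\kappa_i>-1$, put $|\kappa|=\kappa_1+\kappa_2+\kappa_3$, and let $n\ge 0$ be an integer. Write $(a)_k=a(a+1)\cdots(a+k-1)$, and let $P_n^{(a,b)}$ be the classical Jacobi polynomial $P_n^{(a,b)}(y)=\frac{(a+1)_n}{n!}\,{}_2F_1\!\left(-n,n+a+b+1;a+1;\frac{1-y}2\right)$. For $0\le j\le n$ let $$P_{n-j,j}^{\kappa}(x_1,x_2)=P_{n-j}^{(\kappa_2+\kappa_3+2j+1,\kappa_1)}(2x_1-1)\,(1-x_1)^j\,P_j^{(\kappa_3,\kappa_2)}\!\left(\frac{2x_2}{1-x_1}-1\right)$$ (a polynomial in $x_1,x_2$) be the Jacobi polynomials on the triangle $T^2=\{x_1,x_2\ge0,\ x_1+x_2\le1\}$, and let $$A_{n,j}(\kappa)=\frac{\Gamma(|\kappa|+3)}{\prod_{i=1}^{3}\Gamma(\kappa_i+1)}\int_{T^2}\big(P_{n-j,j}^{\kappa}(x)\big)^2x_1^{\kappa_1}x_2^{\kappa_2}(1-x_1-x_2)^{\kappa_3}\,dx$$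 be their squared norms. Put $(12)\kappa=(\kappa_2,\kappa_1,\kappa_3)$. There are unique real numbers $c^{(12)}_{j,m}$, $0\le j,m\le n$ (the connection coefficients for the transposition $(12)$), such that, for $0\le j\le n$ and identically in $x_1,x_2$, $$P^{(12)\kappa}_{n-j,j}(x_2,x_1)=\sum_{m=0}^n c^{(12)}_{j,m}\,P^{\kappa}_{n-m,m}(x_1,x_2).$$ Let $\widehat c^{(12)}_{j,m}=\sqrt{A_{n,m}(\kappa)/A_{n,j}((12)\kappa)}\;c^{(12)}_{j,m}$ be the normalized connection coefficients. For $\sigma=(\alpha,\beta,\gamma,\delta)$ with $\alpha=-n-1$, let $\lambda(x)=x(x+\gamma+\delta+1)$ and let $R_k(\cdot;\sigma)$, $0\le k\le n$, be the Racah polynomials $$R_k(\lambda(x);\sigma)={}_4F_3\!\left(\begin{matrix}-k,\ k+\alpha+\beta+1,\ -x,\ x+\gamma+\delta+1\\ \alpha+1,\ \beta+\delta+1,\ \gamma+1\end{matrix};1\right),$$ with weight $$w_R(x;\sigma)=\frac{(\gamma+\delta+1)_x\left(\frac{\gamma+\delta+3}2\right)_x(\alpha+1)_x(\beta+\delta+1)_x(\gamma+1)_x}{x!\left(\frac{\gamma+\delta+1}2\right)_x(\gamma+\delta-\alpha+1)_x(\gamma-\beta+1)_x(\delta+1)_x},$$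 where for $\gamma+\delta+1=0$ the factor $(\gamma+\delta+1)_x\left(\frac{\gamma+\delta+3}2\right)_x/\left(\frac{\gamma+\delta+1}2\right)_x$ is taken by continuity in $\gamma+\delta$ (this is a removable singularity). Let $\widehat R_k=r_k^{-1/2}R_k$ with $r_k=\sum_{x=0}^n w_R(x;\sigma)R_k(\lambda(x);\sigma)^2$. Then for all $0\le j,m\le n$: (i) $$c^{(12)}_{j,m}=(-1)^{n+m}\frac{(-n)_j(\kappa_2+1)_{n-j}(\kappa_3+1)_j}{j!\,(\kappa_2+1)_m}\cdot\frac{(n+|\kappa|+2)_m}{(\kappa_2+\kappa_3+2m+2)_{n-m}(\kappa_2+\kappa_3+m+1)_m}\;{}_4F_3\!\left(\begin{matrix}-m,\ m+\kappa_2+\kappa_3+1,\ -j,\ j+\kappa_1+\kappa_3+1\\ -n,\ \kappa_3+1,\ n+|\kappa|+2\end{matrix};1\right);$$ (ii) $$\widehat c^{(12)}_{j,m}=(-1)^{n+m+j}\sqrt{w_R(m;\sigma_1)}\;\widehat R_j(\lambda(m);\sigma_1),\qquad \lambda(m)=m(m+\kappa_2+\kappa_3+1),\quad \sigma_1=(-n-1,\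 n+\kappa_1+\kappa_3+1,\ \kappa_3,\ \kappa_2);$$ (iii) $$\widehat c^{(12)}_{j,m}=(-1)^{n+m+j}\sqrt{w_R(j;\sigma_2)}\;\widehat R_m(\lambda(j);\sigma_2),\qquad \lambda(j)=j(j+\kappa_1+\kappa_3+1),\quad \sigma_2=(-n-1,\ n+\kappa_2+\kappa_3+1,\ \kappa_3,\ \kappa_1).$$ -/

import Mathlib

noncomputable section

/-- The rising factorial `(a)_k = a (a+1) ⋯ (a+k-1)`. -/
def poch (a : ℝ) (k : ℕ) : ℝ := (ascPochhammer ℝ k).eval a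

/-- The hypergeometric series `₄F₃(a,b,c,d; e,f,g; z)`. -/
def hyp4F3 (a b c d e f g z : ℝ) : ℝ :=
  ∑' k : ℕ, (poch a k * poch b k * poch c k * poch d k) /
    (poch e k * poch f k * poch g k * (k.factorial : ℝ)) * z ^ k

/-! ### Jacobi polynomials on the triangle -/

/-- Coefficient of `((1-y)/2)^k` in the Jacobi polynomial `P_n^{(a,b)}(y)`. -/
def jacobiCoeff (n : ℕ) (a b : ℝ) (k : ℕ) : ℝ :=
  poch (a + 1) n / (n.factorial : ℝ) *
    (poch (-(n : ℝ)) k * poch ((n : ℝ) + a + b + 1) k / (poch (a + 1) k * (k.factorial : ℝ)))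

/-- The classical Jacobi polynomial
`P_n^{(a,b)}(y) = (a+1)_n / n! * ₂F₁(-n, n+a+b+1; a+1; (1-y)/2)`. -/
def jacobi (n : ℕ) (a b y : ℝ) : ℝ :=
  ∑ k ∈ Finset.range (n + 1), jacobiCoeff n a b k * ((1 - y) / 2) ^ k

/-- The polynomial `s^n P_n^{(a,b)}(2t/s - 1)` in `s` and `t`, written without division so that
it is also correct at `s = 0` (see `homJacobi_eq`). -/
def homJacobi (n : ℕ) (a b s t : ℝ) : ℝ :=
  ∑ k ∈ Finset.range (n + 1), jacobiCoeff n a b k * (s - t) ^ k * s ^ (n - k)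

theorem homJacobi_eq (n : ℕ) (a b s t : ℝ) (hs : s ≠ 0) :
    homJacobi n a b s t = s ^ n * jacobi n a b (2 * t / s - 1) := by
  unfold homJacobi jacobi
  rw [Finset.mul_sum]
  refine Finset.sum_congr rfl fun k hk => ?_
  have hk' : k ≤ n := Nat.lt_succ_iff.mp (Finset.mem_range.mp hk)
  have h1 : (1 - (2 * t / s - 1)) / 2 = (s - t) / s := by
    field_simp
    ring
  rw [h1, div_pow, ← Nat.sub_add_cancel hk', pow_add, Nat.add_sub_cancel]
  field_simp

/-- The Jacobi polynomial `P_{n-j,j}^κ(x₁,x₂)` on the triangle, that is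
`P_{n-j}^{(κ₂+κ₃+2j+1,κ₁)}(2x₁-1) (1-x₁)^j P_j^{(κ₃,κ₂)}(2x₂/(1-x₁)-1)`.
The entries of `κ` are indexed from `0`, so `κ 0` is `κ₁`, etc. -/
def trianglePoly (κ : Fin 3 → ℝ) (n j : ℕ) (x₁ x₂ : ℝ) : ℝ :=
  jacobi (n - j) (κ 1 + κ 2 + 2 * (j : ℝ) + 1) (κ 0) (2 * x₁ - 1) *
    homJacobi j (κ 2) (κ 1) (1 - x₁) x₂

theorem trianglePoly_eq (κ : Fin 3 → ℝ) (n j : ℕ) (x₁ x₂ : ℝ) (h : x₁ ≠ 1) :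
    trianglePoly κ n j x₁ x₂ =
      jacobi (n - j) (κ 1 + κ 2 + 2 * (j : ℝ) + 1) (κ 0) (2 * x₁ - 1) * (1 - x₁) ^ j *
        jacobi j (κ 2) (κ 1) (2 * x₂ / (1 - x₁) - 1) := by
  unfold trianglePoly
  rw [homJacobi_eq _ _ _ _ _ (sub_ne_zero.mpr h.symm), mul_assoc]

/-- The barycentric coordinates `X = (x₁, x₂, 1 - x₁ - x₂)`. -/
def bary (x₁ x₂ : ℝ) : Fin 3 → ℝ := ![x₁, x₂, 1 - x₁ - x₂]

/-- The action of a permutation on triples: `(τ y)_i = y_{τ(i)}`. -/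
def permAct (τ : Equiv.Perm (Fin 3)) (y : Fin 3 → ℝ) : Fin 3 → ℝ := fun i => y (τ i)

/-- The permuted polynomial `P_{n-j,j}^{τκ}((τX)₁, (τX)₂)`. -/
def permTrianglePoly (τ : Equiv.Perm (Fin 3)) (κ : Fin 3 → ℝ) (n j : ℕ) (x₁ x₂ : ℝ) : ℝ :=
  trianglePoly (permAct τ κ) n j (permAct τ (bary x₁ x₂) 0) (permAct τ (bary x₁ x₂) 1)

/-- The triangle `x₁ ≥ 0, x₂ ≥ 0, x₁ + x₂ ≤ 1`. -/
def triangle : Set (ℝ × ℝ) := {p | 0 ≤ p.1 ∧ 0 ≤ p.2 ∧ p.1 + p.2 ≤ 1}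

/-- The Jacobi weight `x₁^κ₁ x₂^κ₂ (1-x₁-x₂)^κ₃`. -/
def triangleWeight (κ : Fin 3 → ℝ) (p : ℝ × ℝ) : ℝ :=
  p.1 ^ κ 0 * p.2 ^ κ 1 * (1 - p.1 - p.2) ^ κ 2

/-- The normalized inner product of the Jacobi weight on the triangle. -/
def triangleInner (κ : Fin 3 → ℝ) (f g : ℝ × ℝ → ℝ) : ℝ :=
  Real.Gamma (κ 0 + κ 1 + κ 2 + 3) /
      (Real.Gamma (κ 0 + 1) * Real.Gamma (κ 1 + 1) * Real.Gamma (κ 2 + 1)) *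
    ∫ p in triangle, f p * g p * triangleWeight κ p

/-- `A_{n-j,j}(κ)`, the squared norm of `P_{n-j,j}^κ`. -/
def triangleNormSq (κ : Fin 3 → ℝ) (n j : ℕ) : ℝ :=
  triangleInner κ (fun p => trianglePoly κ n j p.1 p.2) (fun p => trianglePoly κ n j p.1 p.2)

/-- `c` is the matrix of connection coefficients `c_{j,m}^τ(κ,n)`, `0 ≤ j, m ≤ n`:
`P_{n-j,j}^{τκ}(τx) = ∑_m c_{j,m} P_{n-m,m}^κ(x)` identically in `x`. -/
def IsConnectionMatrix (τ : Equiv.Perm (Fin 3)) (κ : Fin 3 → ℝ) (n : ℕ)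
    (c : Matrix (Fin (n + 1)) (Fin (n + 1)) ℝ) : Prop :=
  ∀ (j : Fin (n + 1)) (x₁ x₂ : ℝ),
    permTrianglePoly τ κ n j x₁ x₂ = ∑ m : Fin (n + 1), c j m * trianglePoly κ n m x₁ x₂

/-- The normalized connection coefficients `√(A_m(κ) / A_j(τκ)) c_{j,m}`. -/
def normalizedConnection (τ : Equiv.Perm (Fin 3)) (κ : Fin 3 → ℝ) (n : ℕ)
    (c : Matrix (Fin (n + 1)) (Fin (n + 1)) ℝ) : Matrix (Fin (n + 1)) (Fin (n + 1)) ℝ :=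
  fun j m => Real.sqrt (triangleNormSq κ n m / triangleNormSq (permAct τ κ) n j) * c j m

/-! ### Racah polynomials of one variable -/

/-- The quadratic lattice `λ(x) = x (x + γ + δ + 1)`. -/
def racahLambda (γ δ x : ℝ) : ℝ := x * (x + γ + δ + 1)

/-- The Racah polynomial `R_n(·; α, β, γ, δ)` as a polynomial in `λ`, for which
`R_n(λ(x)) = ₄F₃(-n, n+α+β+1, -x, x+γ+δ+1; α+1, β+δ+1, γ+1; 1)` (see `racahPoly_eval`). It uses
`(-x)_k (x+γ+δ+1)_k = ∏_{i<k} (i(i+γ+δ+1) - λ(x))`. -/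
def racahPoly (n : ℕ) (α β γ δ : ℝ) : Polynomial ℝ :=
  ∑ k ∈ Finset.range (n + 1),
    Polynomial.C ((poch (-(n : ℝ)) k * poch ((n : ℝ) + α + β + 1) k) /
        (poch (α + 1) k * poch (β + δ + 1) k * poch (γ + 1) k * (k.factorial : ℝ))) *
      ∏ i ∈ Finset.range k, (Polynomial.C (racahLambda γ δ i) - Polynomial.X)

theorem poch_neg_mul_poch (γ δ x : ℝ) (k : ℕ) :
    poch (-x) k * poch (x + γ + δ + 1) k =
      ∏ i ∈ Finset.range k, (racahLambda γ δ i - racahLambda γ δ x) := by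
  induction k with
  | zero => simp [poch]
  | succ k ih =>
    rw [Finset.prod_range_succ, ← ih]
    simp only [poch, ascPochhammer_succ_eval, racahLambda]
    ring

theorem racahPoly_eval (n : ℕ) (α β γ δ x : ℝ) :
    (racahPoly n α β γ δ).eval (racahLambda γ δ x) =
      hyp4F3 (-(n : ℝ)) ((n : ℝ) + α + β + 1) (-x) (x + γ + δ + 1)
        (α + 1) (β + δ + 1) (γ + 1) 1 := by
  unfold hyp4F3 racahPoly
  rw [tsum_eq_sum (s := Finset.range (n + 1))]
  · rw [Polynomial.eval_finsetSum]
    refine Finset.sum_congr rfl fun k _ => ?_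
    rw [Polynomial.eval_mul, Polynomial.eval_C, Polynomial.eval_prod]
    simp only [Polynomial.eval_sub, Polynomial.eval_C, Polynomial.eval_X]
    rw [← poch_neg_mul_poch, one_pow]
    ring
  · intro k hk
    have h : n < k := by
      by_contra h
      exact hk (Finset.mem_range.mpr (by omega))
    have h0 : poch (-(n : ℝ)) k = 0 := ascPochhammer_eval_neg_coe_nat_of_lt h
    simp [h0]

/-- With `s = γ+δ+1`, the factor `(s)_x ((s+2)/2)_x / (s/2)_x` of the Racah weight in its reduced
form: `1` for `x = 0` and `(s+1)_{x-1} (s+2x)` for `x ≥ 1`. The two forms agree where the first has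
no zero denominator (see `racahFactor_eq`); the reduced one also gives the value by
continuity at the removable singularity `s = 0`. -/
def racahFactor (s : ℝ) : ℕ → ℝ
  | 0 => 1
  | x + 1 => poch (s + 1) x * (s + 2 * ((x : ℝ) + 1))

theorem racahFactor_eq (s : ℝ) (x : ℕ) (h : poch (s / 2) x ≠ 0) :
    racahFactor s x = poch s x * poch ((s + 2) / 2) x / poch (s / 2) x := by
  have hleft : ∀ (a : ℝ) (y : ℕ), poch a (y + 1) = a * poch (a + 1) y := by
    intro a y
    simp [poch, ascPochhammer_succ_left, Polynomial.eval_comp]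
  have hright : ∀ (a : ℝ) (y : ℕ), poch a (y + 1) = poch a y * (a + y) := by
    intro a y
    simp [poch, ascPochhammer_succ_eval]
  cases x with
  | zero => simp [racahFactor, poch]
  | succ y =>
    rw [eq_div_iff h]
    have e : (s + 2) / 2 = s / 2 + 1 := by ring
    rw [racahFactor, e, hleft s y, hleft (s / 2) y, hright (s / 2 + 1) y]
    ring

/-- The weight of the Racah polynomials,
`w_R(x) = (γ+δ+1)_x ((γ+δ+3)/2)_x (α+1)_x (β+δ+1)_x (γ+1)_x /
  (x! ((γ+δ+1)/2)_x (γ+δ-α+1)_x (γ-β+1)_x (δ+1)_x)` (see `racahWeight_eq`). -/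
def racahWeight (x : ℕ) (α β γ δ : ℝ) : ℝ :=
  racahFactor (γ + δ + 1) x * (poch (α + 1) x * poch (β + δ + 1) x * poch (γ + 1) x) /
    ((x.factorial : ℝ) * poch (γ + δ - α + 1) x * poch (γ - β + 1) x * poch (δ + 1) x)

theorem racahWeight_eq (x : ℕ) (α β γ δ : ℝ) (h : poch ((γ + δ + 1) / 2) x ≠ 0) :
    racahWeight x α β γ δ =
      (poch (γ + δ + 1) x * poch ((γ + δ + 3) / 2) x * poch (α + 1) x * poch (β + δ + 1) x *
          poch (γ + 1) x) /
        ((x.factorial : ℝ) * poch ((γ + δ + 1) / 2) x * poch (γ + δ - α + 1) x *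
          poch (γ - β + 1) x * poch (δ + 1) x) := by
  have e : (γ + δ + 3) / 2 = (γ + δ + 1 + 2) / 2 := by ring
  rw [racahWeight, racahFactor_eq _ _ h, e]
  simp only [div_eq_mul_inv, mul_inv]
  ring

/-- The squared norm `r_n = ∑_{x=0}^N w_R(x) R_n(λ(x))²`. -/
def racahNormSq (N n : ℕ) (α β γ δ : ℝ) : ℝ :=
  ∑ x ∈ Finset.range (N + 1),
    racahWeight x α β γ δ * ((racahPoly n α β γ δ).eval (racahLambda γ δ x)) ^ 2

/-- The orthonormal Racah polynomial `r_n^{-1/2} R_n`, as a polynomial in `λ`. -/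
def racahOrthonormal (N n : ℕ) (α β γ δ : ℝ) : Polynomial ℝ :=
  Polynomial.C (Real.sqrt (racahNormSq N n α β γ δ))⁻¹ * racahPoly n α β γ δ

end

/-! Both sides of the connection formula have degree at most `n` and are orthogonal, for the weight
with parameters `κ`, to all polynomials of degree below `n`. Such a polynomial is determined by its
values on the edge `x + y = 1` (`eq_zero_of_orthogonal_of_edge`): if it vanishes there it equals `(1
- x - y) q` with `deg q < n`, and pairing it with `q` gives the integral of `(1 - x - y) q ^ 2`
against the weight, which forces `q = 0`.

On that edge the second Jacobi factor degenerates to a constant times a power, so the formula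
becomes a one-variable identity (`jacobi_edge`). Comparing coefficients of the Bernstein monomials
`(1 - t) ^ N * t ^ R` leaves a finite hypergeometric identity (`sum_connection`). Expanding the
`₄F₃` and exchanging the sums, the inner sum over `m` is a very-well-poised `₅F₄`
(`sum_choose_wellPoised`) and the outer one is a Pfaff–Saalschütz sum (`sum_choose_saalschutz`).
Orthogonality of the basis gives uniqueness.

For the first Racah form, the coefficient is a sign times a row factor, a column factor and a Racah
polynomial (`connectionCoeff_eq_racah`), and the norm times the squared column factor is a constant
times the Racah weight (`triangleNormSq_mul_sq`). Parseval's identity (`sum_sq_mul_triangleNormSq`)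
then evaluates the Racah norm, with no appeal to the orthogonality of Racah polynomials. The second
Racah form is the first one for the transposed parameters, since the normalized coefficient is an
inner product of unit vectors and so is symmetric in the two bases (`normalizedConnection_comm`). -/

section

open Finset MeasureTheory

/-! ### Rising factorials -/

theorem poch_zero (a : ℝ) : poch a 0 = 1 := by simp [poch]

theorem poch_succ (a : ℝ) (k : ℕ) : poch a (k + 1) = poch a k * (a + k) := by
  simp [poch, ascPochhammer_succ_eval]

theorem poch_succ_left (a : ℝ) (k : ℕ) : poch a (k + 1) = a * poch (a + 1) k := by
  simp [poch, ascPochhammer_succ_left, Polynomial.eval_comp]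

theorem poch_add (a : ℝ) (k l : ℕ) : poch a (k + l) = poch a k * poch (a + k) l := by
  induction l with
  | zero => simp [poch_zero]
  | succ l ih => rw [← add_assoc, poch_succ, ih, poch_succ]; push_cast; ring

theorem poch_pos {a : ℝ} (ha : 0 < a) (k : ℕ) : 0 < poch a k := ascPochhammer_pos k a ha

theorem poch_one_left (k : ℕ) : poch 1 k = k.factorial := (Nat.cast_factorial ℝ k).symm

theorem poch_natCast_add_one (R N : ℕ) :
    (R.factorial : ℝ) * poch (R + 1) N = (R + N).factorial := by
  rw [← poch_one_left, ← poch_one_left, poch_add, add_comm (1 : ℝ)]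

/-- Reversal of the factors of a rising factorial. -/
theorem poch_neg (a : ℝ) (k : ℕ) : poch (-a - k) k = (-1) ^ k * poch (a + 1) k := by
  induction k generalizing a with
  | zero => simp [poch_zero]
  | succ k ih =>
    rw [poch_succ_left, poch_succ]
    have : -a - ((k + 1 : ℕ) : ℝ) + 1 = -a - k := by push_cast; ring
    rw [this, ih, pow_succ]
    push_cast
    ring

theorem poch_neg_natCast_eq_zero {n k : ℕ} (h : n < k) : poch (-(n : ℝ)) k = 0 :=
  ascPochhammer_eval_neg_coe_nat_of_lt h

theorem poch_neg_natCast (r k : ℕ) :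
    poch (-((r + k : ℕ) : ℝ)) k = (-1) ^ k * poch (r + 1) k := by
  rw [← poch_neg]; congr 1; push_cast; ring

theorem poch_neg_natCast_mul (r k : ℕ) :
    (r.factorial : ℝ) * poch (-((r + k : ℕ) : ℝ)) k = (-1) ^ k * (r + k).factorial := by
  rw [poch_neg_natCast, ← poch_natCast_add_one]; ring

theorem poch_neg_natCast_ne_zero {n k : ℕ} (h : k ≤ n) : poch (-(n : ℝ)) k ≠ 0 := by
  obtain ⟨r, rfl⟩ := Nat.exists_eq_add_of_le' h
  rw [poch_neg_natCast]
  exact mul_ne_zero (by simp) (poch_pos (by positivity) k).ne'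

/-! ### Terminating hypergeometric sums in binomial form -/

/-- Pascal's rule for binomial sums. -/
theorem sum_choose_succ (f : ℕ → ℕ → ℝ) (n : ℕ) :
    ∑ p ∈ antidiagonal (n + 1), ((n + 1).choose p.1 : ℝ) * f p.1 p.2 =
      ∑ p ∈ antidiagonal n, (n.choose p.1 : ℝ) * (f p.1 (p.2 + 1) + f (p.1 + 1) p.2) := by
  rw [Finset.sum_antidiagonal_choose_succ_mul, ← Finset.sum_add_distrib]
  refine Finset.sum_congr rfl fun p hp => ?_
  rw [mul_add, Nat.choose_symm_of_eq_add (mem_antidiagonal.mp hp).symm]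

/-- Absorption, `k * C(n+1, k) = (n+1) * C(n, k-1)`. This and its mirror image lower the length of a
sum whose terms carry a factor equal to one of the two indices. -/
theorem sum_choose_mul_fst (f : ℕ → ℕ → ℝ) (n : ℕ) :
    ∑ p ∈ antidiagonal (n + 1), ((n + 1).choose p.1 : ℝ) * (p.1 * f p.1 p.2) =
      (n + 1) * ∑ p ∈ antidiagonal n, (n.choose p.1 : ℝ) * f (p.1 + 1) p.2 := by
  rw [Finset.Nat.sum_antidiagonal_succ, Finset.mul_sum]
  simp only [Nat.cast_zero, zero_mul, mul_zero, zero_add]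
  refine Finset.sum_congr rfl fun p _ => ?_
  have h := Nat.add_one_mul_choose_eq n p.1
  have h' : ((n : ℝ) + 1) * n.choose p.1 = (n + 1).choose (p.1 + 1) * (p.1 + 1) := by
    exact_mod_cast h
  push_cast
  linear_combination (-f (p.1 + 1) p.2) * h'

theorem sum_choose_mul_snd (f : ℕ → ℕ → ℝ) (n : ℕ) :
    ∑ p ∈ antidiagonal (n + 1), ((n + 1).choose p.1 : ℝ) * (p.2 * f p.1 p.2) =
      (n + 1) * ∑ p ∈ antidiagonal n, (n.choose p.1 : ℝ) * f p.1 (p.2 + 1) := by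
  rw [Finset.Nat.sum_antidiagonal_succ', Finset.mul_sum]
  simp only [Nat.cast_zero, zero_mul, mul_zero, zero_add]
  refine Finset.sum_congr rfl fun p hp => ?_
  have hp' := mem_antidiagonal.mp hp
  have h := Nat.add_one_mul_choose_eq n p.2
  have e1 : (n + 1).choose p.1 = (n + 1).choose (p.2 + 1) :=
    Nat.choose_symm_of_eq_add (by omega)
  have e2 : n.choose p.1 = n.choose p.2 := Nat.choose_symm_of_eq_add (by omega)
  have h' : ((n : ℝ) + 1) * n.choose p.2 = (n + 1).choose (p.2 + 1) * (p.2 + 1) := by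
    exact_mod_cast h
  rw [e1, e2]
  push_cast
  linear_combination (-f p.1 (p.2 + 1)) * h'

/-- The Chu–Vandermonde identity, in alternating form. -/
theorem sum_choose_neg_one_pow_poch (b c : ℝ) (n : ℕ) :
    ∑ p ∈ antidiagonal n, (n.choose p.1 : ℝ) * ((-1) ^ p.1 * poch b p.1 * poch (c + p.1) p.2) =
      poch (c - b) n := by
  induction n generalizing c with
  | zero => simp [poch_zero]
  | succ n ih =>
    -- By Pascal's rule neighbouring terms merge, and `(c + k) - (b + k) = c - b` leaves the same
    -- sum with `c + 1` in place of `c`.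
    rw [sum_choose_succ (fun k r => (-1) ^ k * poch b k * poch (c + k) r), poch_succ_left,
      show c - b + 1 = c + 1 - b by ring, ← ih, Finset.mul_sum]
    refine Finset.sum_congr rfl fun p _ => ?_
    rw [poch_succ b, poch_succ_left (c + p.1), pow_succ]
    push_cast
    rw [show c + 1 + (p.1 : ℝ) = c + p.1 + 1 by ring, show c + ((p.1 : ℝ) + 1) = c + p.1 + 1 by ring]
    ring

theorem poch_add_one_sub (e : ℝ) (r : ℕ) :
    poch (e + 1) (r + 1) - poch e (r + 1) = (r + 1) * poch (e + 1) r := by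
  rw [poch_succ, poch_succ_left]; ring

/-- The Pfaff–Saalschütz identity. -/
theorem sum_choose_saalschutz (a b c : ℝ) (n : ℕ) :
    ∑ p ∈ antidiagonal n, (n.choose p.1 : ℝ) *
      (poch a p.1 * poch b p.1 * poch (c + p.1) p.2 * poch (c - a - b) p.2) =
      poch (c - a) n * poch (c - b) n := by
  induction n using Nat.strong_induction_on generalizing c with
  | _ n ih =>
  match n with
  | 0 => simp [poch_zero]
  | n + 1 =>
    rw [sum_choose_succ (fun k r => poch a k * poch b k * poch (c + k) r * poch (c - a - b) r)]
    -- Write `T n c` for the claimed product. After Pascal's rule the second piece is the sum for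
    -- `(n, c)`; the first has `c + 1` in one factor but still `c - a - b` in the other, so it is
    -- not balanced.
    have key : ∀ p ∈ antidiagonal n, (n.choose p.1 : ℝ) *
        (poch a p.1 * poch b p.1 * poch (c + p.1) (p.2 + 1) * poch (c - a - b) (p.2 + 1) +
          poch a (p.1 + 1) * poch b (p.1 + 1) * poch (c + (p.1 + 1 : ℕ)) p.2 *
            poch (c - a - b) p.2) =
        (c - a) * (c - b) * ((n.choose p.1 : ℝ) * (poch a p.1 * poch b p.1 *
            poch (c + 1 + p.1) p.2 * poch (c - a - b) p.2)) +
          n * (c + n) * ((n.choose p.1 : ℝ) * (poch a p.1 * poch b p.1 * poch (c + p.1) p.2 *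
            poch (c - a - b) p.2)) := by
      intro p hp
      have hn : (n : ℝ) = p.1 + p.2 := by exact_mod_cast (mem_antidiagonal.mp hp).symm
      have h1 : poch (c + p.1) (p.2 + 1) = (c + p.1) * poch (c + 1 + p.1) p.2 := by
        rw [poch_succ_left]; ring_nf
      have h2 : poch (c + p.1) p.2 * (c + n) = (c + p.1) * poch (c + 1 + p.1) p.2 := by
        rw [← h1, poch_succ, hn]; ring
      rw [h1, poch_succ, poch_succ, poch_succ,
        show c + ((p.1 + 1 : ℕ) : ℝ) = c + 1 + p.1 by push_cast; ring]
      linear_combination ((n.choose p.1 : ℝ) * poch a p.1 * poch b p.1 * poch (c - a - b) p.2) *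
        (-(n : ℝ) * h2 + (c + p.1) * poch (c + 1 + p.1) p.2 * (-hn))
    rw [Finset.sum_congr rfl key, Finset.sum_add_distrib, ← Finset.mul_sum, ← Finset.mul_sum,
      ih n (by omega) c]
    -- Balance is restored with `poch_add_one_sub`: replacing `(c - a - b)_r` by `(c + 1 - a - b)_r`
    -- costs a term with factor `r`, which absorption turns into the sum for `(n - 1, c + 1)`. At `n
    -- = 0` the truncated `n - 1` is harmless because of the factor `n`.
    have h3 : ∑ p ∈ antidiagonal n, (n.choose p.1 : ℝ) * (poch a p.1 * poch b p.1 *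
            poch (c + 1 + p.1) p.2 * poch (c - a - b) p.2) =
        poch (c + 1 - a) n * poch (c + 1 - b) n -
          n * (c + n) * (poch (c + 1 - a) (n - 1) * poch (c + 1 - b) (n - 1)) := by
      match n with
      | 0 => simp [poch_zero]
      | n + 1 =>
        rw [← ih (n + 1) (by omega) (c + 1), Nat.add_sub_cancel, ← ih n (by omega) (c + 1),
          eq_sub_iff_add_eq, ← eq_sub_iff_add_eq', ← Finset.sum_sub_distrib]
        have := sum_choose_mul_snd (fun k r => poch a k * poch b k * poch (c + 1 + k) r *
          poch (c + 1 - a - b) (r - 1)) n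
        simp only [Nat.add_sub_cancel] at this
        have e : ∀ p ∈ antidiagonal n, (n.choose p.1 : ℝ) * (poch a p.1 * poch b p.1 *
            poch (c + 1 + p.1) (p.2 + 1) * poch (c + 1 - a - b) p.2) =
            (c + 1 + n) * ((n.choose p.1 : ℝ) * (poch a p.1 * poch b p.1 *
            poch (c + 1 + p.1) p.2 * poch (c + 1 - a - b) p.2)) := by
          intro p hp
          have hn : (n : ℝ) = p.1 + p.2 := by exact_mod_cast (mem_antidiagonal.mp hp).symm
          rw [poch_succ, hn]; ring
        rw [Finset.sum_congr rfl e, ← Finset.mul_sum] at this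
        push_cast
        rw [show (((n : ℝ) + 1) * (c + (n + 1))) = (n + 1) * (c + 1 + n) by ring, mul_assoc, ← this]
        refine Finset.sum_congr rfl fun p _ => ?_
        rcases p with ⟨k, _ | r⟩
        · simp [poch_zero]
        · have := poch_add_one_sub (c - a - b) r
          rw [show c - a - b + 1 = c + 1 - a - b by ring] at this
          simp only [Nat.add_sub_cancel]
          push_cast
          linear_combination (-((n + 1).choose k : ℝ) * poch a k * poch b k *
            poch (c + 1 + k) (r + 1)) * this
    rw [h3]
    -- Since `T n c = (c - a) * (c - b) * T (n - 1) (c + 1)`, the two correction terms cancel.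
    match n with
    | 0 => simp [poch_zero, poch_succ]
    | n + 1 =>
      simp only [Nat.add_sub_cancel]
      rw [poch_succ_left (c - a) (n + 1), poch_succ_left (c - b) (n + 1),
        poch_succ_left (c - a) n, poch_succ_left (c - b) n,
        show c - a + 1 = c + 1 - a by ring, show c - b + 1 = c + 1 - b by ring]
      ring

/-- The reciprocal of `(a+l)_{l+r+1} / (a+2l)`, without its removable singularity. -/
noncomputable def wellPoisedWeight (a : ℝ) (l r : ℕ) : ℝ := (poch (a + l) l * poch (a + 2 * l + 1) r)⁻¹

/-- Here and in the next two lemmas the weights met in the induction are referred to the common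
factor `(a + 1 + l)_{l+r+1}⁻¹`. The corrections there carry a factor `l` or `r`, ready for
absorption. -/
theorem wellPoisedWeight_add_one {a : ℝ} (ha : -1 < a) (l r : ℕ) :
    wellPoisedWeight (a + 1) l r = (a + 1 + 2 * l) * (poch (a + 1 + l) (l + r + 1))⁻¹ := by
  have hl : (0 : ℝ) ≤ l := l.cast_nonneg
  have h : poch (a + 1 + l) (l + r + 1) =
      poch (a + 1 + l) l * ((a + 1 + 2 * l) * poch (a + 1 + 2 * l + 1) r) := by
    rw [add_assoc l, poch_add, poch_succ_left _ r]; ring_nf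
  have h0 : (a + 1 + 2 * l) ≠ 0 := by linarith
  rw [h, wellPoisedWeight]
  generalize a + 1 + 2 * (l : ℝ) = y at *
  generalize poch (y + 1) r = x
  field_simp

/-- At `l = 0` the quotient `l / (a + l)` is `0` even if `a = 0`, by the convention for division by
zero; this is the value needed at the removable singularity. -/
theorem wellPoisedWeight_succ_right {a : ℝ} (ha : -1 < a) (l r : ℕ) :
    wellPoisedWeight a l (r + 1) = (1 + l / (a + l)) * (poch (a + 1 + l) (l + r + 1))⁻¹ := by
  rcases l with _ | l
  · simp [wellPoisedWeight, poch_zero]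
  · have hl : (0 : ℝ) ≤ l := l.cast_nonneg
    have h : poch (a + (l + 1 : ℕ)) (l + 1) * (poch (a + 2 * (l + 1 : ℕ) + 1) (r + 1) * (a + 2 * (l + 1 : ℕ))) =
        (a + (l + 1 : ℕ)) * poch (a + 1 + (l + 1 : ℕ)) (l + 1 + r + 1) := by
      rw [show a + 1 + ((l + 1 : ℕ) : ℝ) = a + (l + 1 : ℕ) + 1 by ring, ← poch_succ_left,
        show l + 1 + r + 1 + 1 = l + 1 + (r + 1 + 1) by ring, poch_add _ (l + 1),
        poch_succ_left _ (r + 1)]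
      push_cast; ring_nf
    have p1 := poch_pos (a := a + (l + 1 : ℕ)) (by push_cast; linarith) (l + 1)
    have p2 := poch_pos (a := a + 2 * (l + 1 : ℕ) + 1) (by push_cast; linarith) (r + 1)
    have p3 := poch_pos (a := a + 1 + (l + 1 : ℕ)) (by push_cast; linarith) (l + 1 + r + 1)
    have p4 : 0 < a + (l + 1 : ℕ) := by push_cast; linarith
    rw [wellPoisedWeight]
    generalize poch (a + (l + 1 : ℕ)) (l + 1) = x at *
    generalize poch (a + 2 * (l + 1 : ℕ) + 1) (r + 1) = y at *
    generalize poch (a + 1 + (l + 1 : ℕ)) (l + 1 + r + 1) = z at *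
    field_simp
    linear_combination -h

theorem wellPoisedWeight_succ_left {a : ℝ} (ha : -1 < a) (l r : ℕ) :
    wellPoisedWeight a (l + 1) r =
      (1 - r / (a + 2 * l + r + 2)) * (poch (a + 1 + l) (l + r + 1))⁻¹ := by
  have hl : (0 : ℝ) ≤ l := l.cast_nonneg
  have hr : (0 : ℝ) ≤ r := r.cast_nonneg
  have h : poch (a + (l + 1 : ℕ)) (l + 1) * (poch (a + 2 * (l + 1 : ℕ) + 1) r * (a + 2 * l + 2)) =
      poch (a + 1 + l) (l + r + 1) * (a + 2 * l + r + 2) := by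
    have : poch (a + 1 + l) (l + r + 1) * (a + 2 * l + r + 2) = poch (a + 1 + l) (l + 1 + (r + 1)) := by
      rw [show l + 1 + (r + 1) = l + r + 1 + 1 by ring, poch_succ _ (l + r + 1)]; push_cast; ring
    rw [this, poch_add _ (l + 1), poch_succ_left _ r]; push_cast; ring_nf
  have p1 := poch_pos (a := a + (l + 1 : ℕ)) (by push_cast; linarith) (l + 1)
  have p2 := poch_pos (a := a + 2 * (l + 1 : ℕ) + 1) (by push_cast; linarith) r
  have p3 := poch_pos (a := a + 1 + l) (by linarith) (l + r + 1)
  have p4 : 0 < a + 2 * l + r + 2 := by linarith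
  rw [wellPoisedWeight]
  generalize poch (a + (l + 1 : ℕ)) (l + 1) = x at *
  generalize poch (a + 2 * (l + 1 : ℕ) + 1) r = y at *
  generalize poch (a + 1 + l) (l + r + 1) = z at *
  field_simp
  linear_combination -h

/-- The terminating very-well-poised `₅F₄` sum. -/
theorem sum_choose_wellPoised {a : ℝ} (ha : -1 < a) (b c : ℝ) (n : ℕ) :
    ∑ p ∈ antidiagonal n, (n.choose p.1 : ℝ) *
      ((-1) ^ p.1 * poch b p.1 * poch c p.1 * poch (1 + a - b + p.1) p.2 *
        poch (1 + a - c + p.1) p.2 * wellPoisedWeight a p.1 p.2) = poch (1 + a - b - c) n := by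
  induction n generalizing a with
  | zero => simp [poch_zero, wellPoisedWeight]
  | succ n ih =>
    rw [sum_choose_succ (fun l r => (-1) ^ l * poch b l * poch c l * poch (1 + a - b + l) r *
        poch (1 + a - c + l) r * wellPoisedWeight a l r), poch_succ_left,
      show 1 + a - b - c + 1 = 1 + (a + 1) - b - c by ring, ← ih (a := a + 1) (by linarith)]
    set Y : ℕ → ℕ → ℝ := fun l r => (-1) ^ l * poch b l * poch c l * poch (2 + a - b + l) r *
        poch (2 + a - c + l) r * (poch (a + 1 + l) (l + r + 1))⁻¹ with hY
    set g : ℕ → ℕ → ℝ := fun l r => Y l r * ((1 + a + l - b) * (1 + a + l - c) / (a + l)) with hg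
    set g' : ℕ → ℕ → ℝ := fun l r => Y l r * ((b + l) * (c + l) / (a + 2 * l + r + 2)) with hg'
    -- Pascal's rule gives the main term, `1 + a - b - c` times the summand for `a + 1`, and
    -- remainders `l * g` and `r * g'`. After absorption the remainders become `g (l + 1) r + g' l
    -- (r + 1)`, which is zero term by term.
    have key : ∀ p ∈ antidiagonal n, (n.choose p.1 : ℝ) *
        ((-1) ^ p.1 * poch b p.1 * poch c p.1 * poch (1 + a - b + p.1) (p.2 + 1) *
        poch (1 + a - c + p.1) (p.2 + 1) * wellPoisedWeight a p.1 (p.2 + 1) +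
        (-1) ^ (p.1 + 1) * poch b (p.1 + 1) * poch c (p.1 + 1) *
          poch (1 + a - b + (p.1 + 1 : ℕ)) p.2 *
        poch (1 + a - c + (p.1 + 1 : ℕ)) p.2 * wellPoisedWeight a (p.1 + 1) p.2) =
        (1 + a - b - c) * ((n.choose p.1 : ℝ) *
      ((-1) ^ p.1 * poch b p.1 * poch c p.1 * poch (1 + (a + 1) - b + p.1) p.2 *
        poch (1 + (a + 1) - c + p.1) p.2 * wellPoisedWeight (a + 1) p.1 p.2)) +
        ((n.choose p.1 : ℝ) * (p.1 * g p.1 p.2) + (n.choose p.1 : ℝ) * (p.2 * g' p.1 p.2)) := by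
      rintro ⟨l, r⟩ -
      simp only [hg, hg', hY]
      rw [wellPoisedWeight_succ_right ha, wellPoisedWeight_succ_left ha,
        wellPoisedWeight_add_one ha, poch_succ b, poch_succ c, pow_succ,
        poch_succ_left (1 + a - b + l),
        poch_succ_left (1 + a - c + l),
        show 1 + a - b + (l : ℝ) + 1 = 2 + a - b + l by ring,
        show 1 + a - c + (l : ℝ) + 1 = 2 + a - c + l by ring,
        show 1 + a - b + ((l + 1 : ℕ) : ℝ) = 2 + a - b + l by push_cast; ring,
        show 1 + a - c + ((l + 1 : ℕ) : ℝ) = 2 + a - c + l by push_cast; ring,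
        show 1 + (a + 1) - b + (l : ℝ) = 2 + a - b + l by ring,
        show 1 + (a + 1) - c + (l : ℝ) = 2 + a - c + l by ring]
      ring
    rw [Finset.sum_congr rfl key, Finset.sum_add_distrib, ← Finset.mul_sum, add_eq_left,
      Finset.sum_add_distrib]
    rcases n with _ | n
    · simp
    rw [sum_choose_mul_fst, sum_choose_mul_snd, ← mul_add, ← Finset.sum_add_distrib]
    refine mul_eq_zero_of_right _ (Finset.sum_eq_zero ?_)
    rintro ⟨l, r⟩ -
    rw [← mul_add]
    refine mul_eq_zero_of_right _ ?_
    have hl : (0 : ℝ) ≤ l := l.cast_nonneg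
    have hr : (0 : ℝ) ≤ r := r.cast_nonneg
    have e1 : poch (a + 1 + l) (l + (r + 1) + 1) * (a + 2 * l + (r + 1 : ℕ) + 2) =
        poch (a + 1 + (l + 1 : ℕ)) (l + 1 + r + 1) * (a + (l + 1 : ℕ)) := by
      have h1 : poch (a + 1 + l) (l + (r + 1) + 1) * (a + 2 * l + (r + 1 : ℕ) + 2) =
          poch (a + 1 + l) (l + (r + 1) + 1 + 1) := by
        rw [poch_succ _ (l + (r + 1) + 1)]; push_cast; ring
      rw [h1, poch_succ_left, show l + (r + 1) + 1 = l + 1 + r + 1 by ring]; push_cast; ring_nf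
    have p1 := poch_pos (a := a + 1 + l) (by linarith) (l + (r + 1) + 1)
    have p2 := poch_pos (a := a + 1 + (l + 1 : ℕ)) (by push_cast; linarith) (l + 1 + r + 1)
    have p3 : 0 < a + 2 * l + (r + 1 : ℕ) + 2 := by push_cast; linarith
    have p4 : 0 < a + (l + 1 : ℕ) := by push_cast; linarith
    have e2 : (poch (a + 1 + l) (l + (r + 1) + 1))⁻¹ / (a + 2 * l + (r + 1 : ℕ) + 2) =
        (poch (a + 1 + (l + 1 : ℕ)) (l + 1 + r + 1))⁻¹ / (a + (l + 1 : ℕ)) := by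
      rw [inv_div_left, inv_div_left, mul_comm _ (poch _ _), mul_comm _ (poch _ _), e1]
    simp only [hg, hg', hY]
    rw [poch_succ b, poch_succ c, pow_succ, poch_succ_left (2 + a - b + l), poch_succ_left (2 + a - c + l),
      show 2 + a - b + ((l + 1 : ℕ) : ℝ) = 2 + a - b + l + 1 by push_cast; ring,
      show 2 + a - c + ((l + 1 : ℕ) : ℝ) = 2 + a - c + l + 1 by push_cast; ring]
    rw [show 1 + a + ((l + 1 : ℕ) : ℝ) - b = 2 + a - b + l by push_cast; ring,
      show 1 + a + ((l + 1 : ℕ) : ℝ) - c = 2 + a - c + l by push_cast; ring]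
    linear_combination ((-1) ^ l * poch b l * poch c l * (2 + a - b + l) * (2 + a - c + l) *
      poch (2 + a - b + l + 1) r * poch (2 + a - c + l + 1) r * (b + l) * (c + l)) * e2

/-! ### Jacobi polynomials in the Bernstein basis -/

theorem jacobiCoeff_eq {a : ℝ} (ha : -1 < a) (b : ℝ) (k r : ℕ) :
    jacobiCoeff (k + r) a b k = ((k + r).choose k : ℝ) * (-1) ^ k *
      (poch ((k + r : ℕ) + a + b + 1) k * poch (a + 1 + k) r) / ((k + r).factorial : ℝ) := by
  have h1 := poch_neg_natCast_mul r k
  have h2 : ((k + r).choose k : ℝ) * k.factorial * r.factorial = (k + r).factorial := by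
    rw [Nat.choose_symm_add]; exact_mod_cast Nat.add_choose_mul_factorial_mul_factorial k r
  have h3 := (poch_pos (a := a + 1) (by linarith) k).ne'
  have h4 : (k.factorial : ℝ) ≠ 0 := by positivity
  have h5 : (r.factorial : ℝ) ≠ 0 := by positivity
  have h6 : ((k + r).factorial : ℝ) ≠ 0 := by positivity
  rw [add_comm r k] at h1
  have h7 : poch (-((k + r : ℕ) : ℝ)) k = (-1) ^ k * ((k + r).choose k : ℝ) * k.factorial := by
    apply mul_left_cancel₀ h5
    rw [h1, ← h2]; ring
  rw [jacobiCoeff, poch_add, h7]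
  field_simp

theorem jacobi_eval (n : ℕ) (a b t : ℝ) :
    jacobi n a b (2 * t - 1) = ∑ k ∈ range (n + 1), jacobiCoeff n a b k * (1 - t) ^ k := by
  rw [jacobi, show (1 - (2 * t - 1)) / 2 = 1 - t by ring]

theorem sum_antidiagonal_assoc (F : ℕ → ℕ → ℕ → ℝ) (n : ℕ) :
    ∑ p ∈ antidiagonal n, ∑ q ∈ antidiagonal p.1, F q.1 q.2 p.2 =
      ∑ p ∈ antidiagonal n, ∑ q ∈ antidiagonal p.2, F p.1 q.1 q.2 := by
  rw [Finset.sum_sigma', Finset.sum_sigma']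
  refine Finset.sum_nbij' (fun x => ⟨(x.2.1, x.2.2 + x.1.2), (x.2.2, x.1.2)⟩)
    (fun x => ⟨(x.1.1 + x.2.1, x.2.2), (x.1.1, x.2.1)⟩) ?_ ?_ ?_ ?_ ?_ <;>
  · rintro ⟨⟨i, j⟩, ⟨k, l⟩⟩ h
    simp only [mem_sigma, HasAntidiagonal.mem_antidiagonal] at h
    obtain ⟨rfl, rfl⟩ := h
    simp [add_assoc]

/-- The Bernstein form of the Jacobi polynomials. -/
theorem jacobi_bernstein {a : ℝ} (ha : -1 < a) (b : ℝ) (n : ℕ) (t : ℝ) :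
    jacobi n a b (2 * t - 1) = ((n.factorial : ℝ))⁻¹ *
      ∑ p ∈ antidiagonal n, (n.choose p.1 : ℝ) * ((-1) ^ p.1 * poch (a + p.1 + 1) p.2 *
        poch (b + p.2 + 1) p.1 * (1 - t) ^ p.1 * t ^ p.2) := by
  have e1 : jacobi n a b (2 * t - 1) = ((n.factorial : ℝ))⁻¹ *
      ∑ p ∈ antidiagonal n, (n.choose p.1 : ℝ) * ((-1) ^ p.1 * poch (a + 1 + p.1) p.2 *
        poch (n + a + b + 1) p.1 * (1 - t) ^ p.1) := by
    rw [jacobi_eval, ← Finset.Nat.sum_antidiagonal_eq_sum_range_succ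
      (fun k _ => jacobiCoeff n a b k * (1 - t) ^ k), Finset.mul_sum]
    refine Finset.sum_congr rfl fun p hp => ?_
    obtain rfl := mem_antidiagonal.mp hp
    rw [jacobiCoeff_eq ha]
    ring
  rw [e1]
  congr 1
  -- Chu–Vandermonde splits `(n + a + b + 1)_k` as the difference of `a + 1` and `-n - b`. After
  -- regrouping the triple sum, the inner sum is the binomial expansion of `t ^ r = (1 - (1 - t)) ^
  -- r`.
  have e2 : ∀ p ∈ antidiagonal n, (n.choose p.1 : ℝ) * ((-1) ^ p.1 * poch (a + 1 + p.1) p.2 *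
        poch (n + a + b + 1) p.1 * (1 - t) ^ p.1) =
      ∑ q ∈ antidiagonal p.1, (n.choose q.1 : ℝ) * ((q.2 + p.2).choose q.2) *
        ((-1) ^ (q.1 + q.2) * (1 - t) ^ (q.1 + q.2) * ((-1) ^ q.1 * poch (-(n : ℝ) - b) q.1) *
          poch (a + 1 + q.1) (q.2 + p.2)) := by
    rintro ⟨k, r⟩ hp
    obtain rfl := mem_antidiagonal.mp hp
    rw [show ((k + r : ℕ) : ℝ) + a + b + 1 = a + 1 - (-((k + r : ℕ) : ℝ) - b) by ring,
      ← sum_choose_neg_one_pow_poch, Finset.mul_sum, Finset.sum_mul, Finset.mul_sum]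
    refine Finset.sum_congr rfl fun q hq => ?_
    obtain rfl := mem_antidiagonal.mp hq
    have h1 : ((q.1 + q.2 + r).choose (q.1 + q.2) : ℝ) * (q.1 + q.2).choose q.1 =
        (q.1 + q.2 + r).choose q.1 * ((q.2 + r).choose q.2) := by
      have := Nat.choose_mul (n := q.1 + q.2 + r) (k := q.1 + q.2) (s := q.1) (by omega)
      rw [show q.1 + q.2 + r - q.1 = q.2 + r by omega, Nat.add_sub_cancel_left] at this
      exact_mod_cast this
    rw [poch_add (a + 1 + q.1)]
    push_cast
    rw [show a + 1 + ((q.1 : ℝ) + q.2) = a + 1 + q.1 + q.2 by ring]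
    linear_combination ((-1) ^ (q.1 + q.2) * poch (a + 1 + q.1 + q.2) r *
      ((-1) ^ q.1 * poch (-((q.1 : ℝ) + q.2 + r) - b) q.1 * poch (a + 1 + q.1) q.2) *
      (1 - t) ^ (q.1 + q.2)) * h1
  rw [Finset.sum_congr rfl e2, sum_antidiagonal_assoc (fun k x y => (n.choose k : ℝ) *
    ((x + y).choose x) * ((-1) ^ (k + x) * (1 - t) ^ (k + x) * ((-1) ^ k * poch (-(n : ℝ) - b) k) *
          poch (a + 1 + k) (x + y)))]
  refine Finset.sum_congr rfl ?_
  rintro ⟨k, r⟩ hp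
  obtain rfl := mem_antidiagonal.mp hp
  have h2 : t ^ r = ∑ q ∈ antidiagonal r, (r.choose q.1 : ℝ) * ((-(1 - t)) ^ q.1 * 1 ^ q.2) := by
    have := (Commute.all (-(1 - t)) 1).add_pow' r
    rw [show -(1 - t) + 1 = t by ring] at this
    simpa [nsmul_eq_mul] using this
  have h3 : (-1) ^ k * poch (-((k + r : ℕ) : ℝ) - b) k = poch (b + r + 1) k := by
    have := poch_neg (b + r) k
    rw [show -(b + r) - (k : ℝ) = -((k + r : ℕ) : ℝ) - b by push_cast; ring] at this
    rw [this, ← mul_assoc, ← mul_pow]; simp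
  rw [h2, Finset.mul_sum, Finset.mul_sum]
  refine Finset.sum_congr rfl fun q hq => ?_
  obtain rfl := mem_antidiagonal.mp hq
  simp only
  rw [h3, neg_pow (1 - t), one_pow, pow_add, pow_add, add_right_comm a]
  ring

/-! ### Integration against the Jacobi weight on the unit interval -/

noncomputable def jacobiMass (a b : ℝ) : ℝ := Real.Gamma (a + 1) * Real.Gamma (b + 1) / Real.Gamma (a + b + 2)

theorem jacobiMass_pos {a b : ℝ} (ha : -1 < a) (hb : -1 < b) : 0 < jacobiMass a b :=
  div_pos (mul_pos (Real.Gamma_pos_of_pos (by linarith)) (Real.Gamma_pos_of_pos (by linarith)))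
    (Real.Gamma_pos_of_pos (by linarith))

theorem Gamma_add_nat {x : ℝ} (hx : 0 < x) (k : ℕ) :
    Real.Gamma (x + k) = poch x k * Real.Gamma x := by
  induction k with
  | zero => simp [poch_zero]
  | succ k ih =>
    have : x + k ≠ 0 := by positivity
    rw [Nat.cast_succ, ← add_assoc, Real.Gamma_add_one this, ih, poch_succ]; ring

theorem jacobiMass_add_nat {a b : ℝ} (ha : -1 < a) (hb : -1 < b) (k i : ℕ) :
    jacobiMass (a + k) (b + i) =
      jacobiMass a b * (poch (a + 1) k * poch (b + 1) i / poch (a + b + 2) (k + i)) := by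
  rw [jacobiMass, jacobiMass, show a + k + 1 = a + 1 + k by ring, show b + i + 1 = b + 1 + i by ring,
    show a + k + (b + i) + 2 = a + b + 2 + (k + i : ℕ) by push_cast; ring,
    Gamma_add_nat (by linarith), Gamma_add_nat (by linarith), Gamma_add_nat (by linarith),
    div_mul_div_comm]
  ring_nf

/-- The density of the Beta distribution with parameters `b + 1` and `a + 1` has total mass one. As
in `P_n^{(a,b)}`, the parameter `a` is the exponent of `1 - t`. -/
theorem lintegral_jacobiWeight {a b : ℝ} (ha : -1 < a) (hb : -1 < b) :
    ∫⁻ t in Set.Ioo (0 : ℝ) 1, ENNReal.ofReal (t ^ b * (1 - t) ^ a) =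
      ENNReal.ofReal (jacobiMass a b) := by
  have h := ProbabilityTheory.lintegral_betaPDF_eq_one (α := b + 1) (β := a + 1)
    (by linarith) (by linarith)
  have hB : ProbabilityTheory.beta (b + 1) (a + 1) = jacobiMass a b := by
    rw [ProbabilityTheory.beta, jacobiMass, mul_comm]; ring_nf
  have hp := jacobiMass_pos ha hb
  rw [ProbabilityTheory.lintegral_betaPDF, hB] at h
  simp only [add_sub_cancel_right] at h
  calc _ = ∫⁻ t in Set.Ioo (0 : ℝ) 1, ENNReal.ofReal (jacobiMass a b) *
        ENNReal.ofReal (1 / jacobiMass a b * t ^ b * (1 - t) ^ a) := by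
        refine lintegral_congr fun t => ?_
        rw [← ENNReal.ofReal_mul hp.le]
        congr 1
        field_simp
    _ = _ := by
      rw [lintegral_const_mul _ (by fun_prop), h, mul_one]

theorem jacobiWeight_nonneg (a b : ℝ) :
    0 ≤ᵐ[volume.restrict (Set.Ioo (0 : ℝ) 1)] fun t : ℝ => t ^ b * (1 - t) ^ a := by
  refine ae_restrict_of_forall_mem measurableSet_Ioo fun t ht => ?_
  exact mul_nonneg (Real.rpow_nonneg ht.1.le _) (Real.rpow_nonneg (by linarith [ht.2]) _)

theorem integrableOn_jacobiWeight {a b : ℝ} (ha : -1 < a) (hb : -1 < b) :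
    IntegrableOn (fun t : ℝ => t ^ b * (1 - t) ^ a) (Set.Ioo 0 1) := by
  refine ⟨Measurable.aestronglyMeasurable (by fun_prop), ?_⟩
  rw [hasFiniteIntegral_iff_ofReal (jacobiWeight_nonneg a b), lintegral_jacobiWeight ha hb]
  exact ENNReal.ofReal_lt_top

theorem integral_jacobiWeight {a b : ℝ} (ha : -1 < a) (hb : -1 < b) :
    ∫ t in Set.Ioo (0 : ℝ) 1, t ^ b * (1 - t) ^ a = jacobiMass a b := by
  rw [integral_eq_lintegral_of_nonneg_ae (jacobiWeight_nonneg a b)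
    (Measurable.aestronglyMeasurable (by fun_prop)), lintegral_jacobiWeight ha hb,
    ENNReal.toReal_ofReal (jacobiMass_pos ha hb).le]

/-- Integration on `[0,1]` against the Jacobi weight `t^b (1-t)^a`. -/
noncomputable def jacobiIntegral (a b : ℝ) (f : ℝ → ℝ) : ℝ :=
  ∫ t in Set.Ioo (0 : ℝ) 1, f t * (t ^ b * (1 - t) ^ a)

theorem integrableOn_mul_jacobiWeight {a b : ℝ} (ha : -1 < a) (hb : -1 < b) {f : ℝ → ℝ}
    (hf : Continuous f) :
    IntegrableOn (fun t : ℝ => f t * (t ^ b * (1 - t) ^ a)) (Set.Ioo 0 1) :=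
  (integrableOn_jacobiWeight ha hb).continuousOn_mul_of_subset hf.continuousOn isCompact_Icc
    measurableSet_Ioo Set.Ioo_subset_Icc_self

theorem jacobiIntegral_sum {a b : ℝ} (ha : -1 < a) (hb : -1 < b) {ι : Type*} (s : Finset ι)
    (c : ι → ℝ) (f : ι → ℝ → ℝ) (hf : ∀ i, Continuous (f i)) :
    jacobiIntegral a b (fun t => ∑ i ∈ s, c i * f i t) = ∑ i ∈ s, c i * jacobiIntegral a b (f i) := by
  unfold jacobiIntegral
  simp_rw [Finset.sum_mul, mul_assoc (c _)]
  rw [integral_finsetSum _ fun i _ => (integrableOn_mul_jacobiWeight ha hb (hf i)).const_mul _]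
  simp_rw [integral_const_mul]

theorem jacobiIntegral_mul_pow (a b : ℝ) (f : ℝ → ℝ) (k i : ℕ) :
    jacobiIntegral a b (fun t => f t * ((1 - t) ^ k * t ^ i)) = jacobiIntegral (a + k) (b + i) f := by
  unfold jacobiIntegral
  refine setIntegral_congr_fun measurableSet_Ioo fun t ht => ?_
  have h1 : 0 < t := ht.1
  have h2 : 0 < 1 - t := by linarith [ht.2]
  simp only [Real.rpow_add h1, Real.rpow_add h2, Real.rpow_natCast]
  ring

theorem jacobiIntegral_pow {a b : ℝ} (ha : -1 < a) (hb : -1 < b) (k i : ℕ) :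
    jacobiIntegral a b (fun t => (1 - t) ^ k * t ^ i) =
      jacobiMass a b * (poch (a + 1) k * poch (b + 1) i / poch (a + b + 2) (k + i)) := by
  have hk : (0 : ℝ) ≤ k := k.cast_nonneg
  have hi : (0 : ℝ) ≤ i := i.cast_nonneg
  have := jacobiIntegral_mul_pow a b (fun _ => 1) k i
  simp only [one_mul] at this
  rw [this, ← jacobiMass_add_nat ha hb, ← integral_jacobiWeight (by linarith) (by linarith)]
  simp [jacobiIntegral]

theorem continuous_jacobi (n : ℕ) (a b : ℝ) : Continuous (jacobi n a b) := by
  unfold jacobi; fun_prop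

/-- Termwise Beta integrals are summed by Chu–Vandermonde. The factor `(i + 1 - n)_n` vanishes for
`i < n`, which is the orthogonality of the Jacobi polynomials. -/
theorem jacobiIntegral_jacobi_mul_pow {a b : ℝ} (ha : -1 < a) (hb : -1 < b) (n i : ℕ) :
    jacobiIntegral a b (fun t => jacobi n a b (2 * t - 1) * t ^ i) =
      jacobiMass a b * (poch (a + 1) n * poch (b + 1) i * poch (i + 1 - n) n /
        (n.factorial * poch (a + b + 2) (i + n))) := by
  have hk : ∀ k : ℕ, 0 < poch (a + b + 2) k := poch_pos (by linarith)
  simp_rw [jacobi_eval, Finset.sum_mul, mul_assoc]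
  rw [jacobiIntegral_sum ha hb _ _ (fun k t => (1 - t) ^ k * t ^ i) (fun k => by fun_prop)]
  simp_rw [jacobiIntegral_pow ha hb]
  rw [← Finset.Nat.sum_antidiagonal_eq_sum_range_succ
      (fun k _ => jacobiCoeff n a b k * (jacobiMass a b *
        (poch (a + 1) k * poch (b + 1) i / poch (a + b + 2) (k + i))))]
  rw [show (i : ℝ) + 1 - n = a + b + 2 + i - (n + a + b + 1) by ring,
    ← sum_choose_neg_one_pow_poch, Finset.mul_sum, Finset.mul_sum, Finset.sum_div,
    Finset.mul_sum]
  refine Finset.sum_congr rfl fun p hp => ?_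
  obtain rfl := mem_antidiagonal.mp hp
  have h1 : poch (a + b + 2) (i + (p.1 + p.2)) =
      poch (a + b + 2) (p.1 + i) * poch (a + b + 2 + i + p.1) p.2 := by
    rw [← add_assoc, poch_add _ (i + p.1), add_comm i]; push_cast; ring_nf
  have h2 : poch (a + 1) (p.1 + p.2) = poch (a + 1) p.1 * poch (a + 1 + p.1) p.2 := poch_add _ _ _
  have h3 : 0 < poch (a + b + 2 + i + p.1) p.2 := by
    refine poch_pos ?_ _
    have : (0 : ℝ) ≤ i := i.cast_nonneg
    have : (0 : ℝ) ≤ p.1 := p.1.cast_nonneg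
    linarith
  have h4 := hk (p.1 + i)
  rw [jacobiCoeff_eq ha, h1, h2]
  field_simp

/-- The Jacobi polynomial `P_n^{(a,b)}(2t-1)` as a polynomial in `t`. -/
noncomputable def jacobiPolynomial (n : ℕ) (a b : ℝ) : Polynomial ℝ :=
  ∑ k ∈ range (n + 1), Polynomial.C (jacobiCoeff n a b k) * (1 - Polynomial.X) ^ k

theorem jacobiPolynomial_eval (n : ℕ) (a b t : ℝ) :
    (jacobiPolynomial n a b).eval t = jacobi n a b (2 * t - 1) := by
  simp [jacobi_eval, jacobiPolynomial, Polynomial.eval_finsetSum]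

theorem natDegree_one_sub_X_pow_le (k : ℕ) : ((1 - Polynomial.X : Polynomial ℝ) ^ k).natDegree ≤ k := by
  refine (Polynomial.natDegree_pow_le).trans ?_
  have : (1 - Polynomial.X : Polynomial ℝ).natDegree ≤ 1 := by compute_degree
  nlinarith

theorem jacobiPolynomial_natDegree_le (n : ℕ) (a b : ℝ) : (jacobiPolynomial n a b).natDegree ≤ n := by
  refine Polynomial.natDegree_sum_le_of_forall_le _ _ fun k hk => ?_
  refine (Polynomial.natDegree_C_mul_le _ _).trans ((natDegree_one_sub_X_pow_le k).trans ?_)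
  exact Nat.lt_succ_iff.mp (mem_range.mp hk)

theorem jacobiPolynomial_coeff {a : ℝ} (ha : -1 < a) (b : ℝ) (n : ℕ) :
    (jacobiPolynomial n a b).coeff n = poch (n + a + b + 1) n / n.factorial := by
  have h := jacobiCoeff_eq ha b n 0
  have h2 : ((1 - Polynomial.X : Polynomial ℝ) ^ n).coeff n = (-1) ^ n := by
    have := Polynomial.coeff_pow_of_natDegree_le (p := (1 - Polynomial.X : Polynomial ℝ)) (m := n)
      (n := 1) (by compute_degree)
    rw [mul_one] at this
    rw [this]; simp [Polynomial.coeff_one]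
  simp only [add_zero, Nat.choose_self, poch_zero] at h
  have h3 : ((-1 : ℝ) ^ n) * (-1) ^ n = 1 := by rw [← mul_pow]; simp
  rw [jacobiPolynomial, Polynomial.finsetSum_coeff, Finset.sum_range_succ, Finset.sum_eq_zero,
    zero_add, Polynomial.coeff_C_mul, h, h2]
  · push_cast
    linear_combination (poch (n + a + b + 1) n / n.factorial) * h3
  · intro k hk
    rw [Polynomial.coeff_C_mul, Polynomial.coeff_eq_zero_of_natDegree_lt, mul_zero]
    exact (natDegree_one_sub_X_pow_le k).trans_lt (mem_range.mp hk)

/-- Moments of order below `n` vanish, so only the coefficient of degree `n` contributes. This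
yields both the orthogonality and the squared norm. -/
theorem jacobiIntegral_jacobi_mul {a b : ℝ} (ha : -1 < a) (hb : -1 < b) {n : ℕ} {p : Polynomial ℝ}
    (hp : p.natDegree ≤ n) :
    jacobiIntegral a b (fun t => jacobi n a b (2 * t - 1) * p.eval t) =
      p.coeff n * (jacobiMass a b * (poch (a + 1) n * poch (b + 1) n / poch (a + b + 2) (2 * n))) := by
  have hc := continuous_jacobi n a b
  simp_rw [Polynomial.eval_eq_sum_range' (Nat.lt_succ_of_le hp), Finset.mul_sum, ← mul_assoc,
    mul_comm _ (p.coeff _), mul_assoc]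
  rw [jacobiIntegral_sum ha hb _ _ (fun i t => jacobi n a b (2 * t - 1) * t ^ i)
    (fun k => by fun_prop), Finset.sum_range_succ, Finset.sum_eq_zero, zero_add,
    jacobiIntegral_jacobi_mul_pow ha hb, two_mul, add_sub_cancel_left, poch_one_left]
  · have : (n.factorial : ℝ) ≠ 0 := by positivity
    field_simp
  · intro i hi
    rw [jacobiIntegral_jacobi_mul_pow ha hb]
    have : (i : ℝ) + 1 - n = -((n - 1 - i : ℕ) : ℝ) := by
      have := mem_range.mp hi
      rw [Nat.cast_sub (by omega), Nat.cast_sub (by omega)]; push_cast; ring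
    rw [this, poch_neg_natCast_eq_zero (by have := mem_range.mp hi; omega)]
    simp

/-- The squared norm of a Jacobi polynomial on `[0,1]`. -/
noncomputable def jacobiNormSq (n : ℕ) (a b : ℝ) : ℝ :=
  poch (n + a + b + 1) n / n.factorial *
    (jacobiMass a b * (poch (a + 1) n * poch (b + 1) n / poch (a + b + 2) (2 * n)))

theorem jacobiIntegral_jacobi_sq {a b : ℝ} (ha : -1 < a) (hb : -1 < b) (n : ℕ) :
    jacobiIntegral a b (fun t => jacobi n a b (2 * t - 1) * jacobi n a b (2 * t - 1)) =
      jacobiNormSq n a b := by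
  have := jacobiIntegral_jacobi_mul ha hb (jacobiPolynomial_natDegree_le n a b)
  simp_rw [jacobiPolynomial_eval, jacobiPolynomial_coeff ha] at this
  exact this

theorem jacobiIntegral_jacobi_mul_eq_zero {a b : ℝ} (ha : -1 < a) (hb : -1 < b) {n : ℕ}
    {p : Polynomial ℝ} (hp : p.natDegree < n) :
    jacobiIntegral a b (fun t => jacobi n a b (2 * t - 1) * p.eval t) = 0 := by
  rw [jacobiIntegral_jacobi_mul ha hb hp.le, Polynomial.coeff_eq_zero_of_natDegree_lt hp, zero_mul]

/-! ### Integration on the triangle in Duffy coordinates -/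

/-- The Duffy transformation of the unit square onto the triangle. -/
def duffy (q : ℝ × ℝ) : ℝ × ℝ := (q.1, (1 - q.1) * q.2)

noncomputable def fderivDuffy (q : ℝ × ℝ) : ℝ × ℝ →L[ℝ] ℝ × ℝ :=
  LinearMap.toContinuousLinearMap (Matrix.toLin (Module.Basis.finTwoProd ℝ)
    (Module.Basis.finTwoProd ℝ) !![1, 0; -q.2, 1 - q.1])

theorem hasFDerivAt_duffy (q : ℝ × ℝ) : HasFDerivAt duffy (fderivDuffy q) q := by
  unfold fderivDuffy
  rw [Matrix.toLin_finTwoProd_toContinuousLinearMap]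
  have h1 : HasFDerivAt (fun q : ℝ × ℝ => q.1) (ContinuousLinearMap.fst ℝ ℝ ℝ) q := hasFDerivAt_fst
  have h2 : HasFDerivAt (fun q : ℝ × ℝ => q.2) (ContinuousLinearMap.snd ℝ ℝ ℝ) q := hasFDerivAt_snd
  refine HasFDerivAt.congr_fderiv (h1.prodMk ((h1.const_sub (1 : ℝ)).mul h2)) ?_
  ext <;> simp

theorem det_fderivDuffy (q : ℝ × ℝ) : (fderivDuffy q).det = 1 - q.1 := by
  unfold fderivDuffy
  rw [LinearMap.det_toContinuousLinearMap, LinearMap.det_toLin, Matrix.det_fin_two_of]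
  ring

theorem injOn_duffy : Set.InjOn duffy (Set.Ico 0 1 ×ˢ Set.Icc 0 1) := by
  rintro ⟨x, t⟩ ⟨h, -⟩ ⟨x', t'⟩ - h'
  simp only [duffy, Prod.mk.injEq] at h'
  obtain ⟨rfl, h'⟩ := h'
  have : (1 - x) ≠ 0 := by have := h.2; simp only at this; linarith
  rw [mul_left_cancel₀ this h']

theorem image_duffy : duffy '' (Set.Ico 0 1 ×ˢ Set.Icc 0 1) = triangle \ {(1, 0)} := by
  ext ⟨x, y⟩
  constructor
  · rintro ⟨⟨x', t⟩, ⟨⟨h1, h2⟩, h3, h4⟩, h⟩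
    simp only [duffy, Prod.mk.injEq] at h h1 h2 h3 h4
    obtain ⟨rfl, rfl⟩ := h
    refine ⟨⟨h1, mul_nonneg (by linarith) h3, ?_⟩, ?_⟩
    · simp only; nlinarith
    · simp only [Set.mem_singleton_iff, Prod.mk.injEq, not_and]; intro h; linarith
  · rintro ⟨⟨h1, h2, h3⟩, h4⟩
    simp only [Set.mem_singleton_iff, Prod.mk.injEq, not_and] at h1 h2 h3 h4
    have hx : x < 1 := by
      rcases lt_or_eq_of_le (show x ≤ 1 by linarith) with h | h
      · exact h
      · exact absurd (by linarith) (h4 h)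
    have h5 : 0 < 1 - x := by linarith
    refine ⟨(x, y / (1 - x)), ⟨⟨h1, hx⟩, ⟨by simp only; positivity, ?_⟩⟩, ?_⟩
    · simp only; rw [div_le_one h5]; linarith
    · simp only [duffy]; field_simp

/-- The third barycentric coordinate becomes `(1 - x) * (1 - t)`, so the weight separates; the extra
`1` in the exponent of `1 - x` is the Jacobian. -/
theorem triangleWeight_duffy (κ : Fin 3 → ℝ) {x t : ℝ} (hx : x ∈ Set.Ioo (0 : ℝ) 1)
    (ht : t ∈ Set.Ioo (0 : ℝ) 1) :
    (1 - x) * triangleWeight κ (duffy (x, t)) =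
      (x ^ κ 0 * (1 - x) ^ (κ 1 + κ 2 + 1)) * (t ^ κ 1 * (1 - t) ^ κ 2) := by
  have h1 : 0 < 1 - x := by linarith [hx.2]
  have h2 : 0 < 1 - t := by linarith [ht.2]
  simp only [triangleWeight, duffy]
  rw [show 1 - x - (1 - x) * t = (1 - x) * (1 - t) by ring, Real.mul_rpow h1.le ht.1.le,
    Real.mul_rpow h1.le h2.le, Real.rpow_add h1, Real.rpow_add h1, Real.rpow_one]
  ring

/-- The domain on which the transformation is injective misses only the vertex `(1, 0)`, a null set.
-/
theorem restrict_triangle : volume.restrict triangle =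
    volume.restrict (duffy '' (Set.Ico 0 1 ×ˢ Set.Icc 0 1)) := by
  rw [image_duffy]
  exact (Measure.restrict_congr_set (sdiff_null_ae_eq_self (measure_singleton _))).symm

theorem restrict_square : (volume : Measure (ℝ × ℝ)).restrict (Set.Ico 0 1 ×ˢ Set.Icc 0 1) =
    volume.restrict (Set.Ioo 0 1 ×ˢ Set.Ioo 0 1) := by
  rw [Measure.volume_eq_prod, ← Measure.prod_restrict, ← Measure.prod_restrict,
    Measure.restrict_congr_set (Ioo_ae_eq_Ico (μ := (volume : Measure ℝ)) (a := 0) (b := 1)).symm,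
    Measure.restrict_congr_set (Ioo_ae_eq_Icc (μ := (volume : Measure ℝ)) (a := 0) (b := 1)).symm]

theorem setIntegrand_duffy (κ : Fin 3 → ℝ) (F : ℝ × ℝ → ℝ) :
    Set.EqOn (fun q => |(fderivDuffy q).det| • (F (duffy q) * triangleWeight κ (duffy q)))
      (fun q => F (duffy q) * ((q.1 ^ κ 0 * (1 - q.1) ^ (κ 1 + κ 2 + 1)) *
        (q.2 ^ κ 1 * (1 - q.2) ^ κ 2))) (Set.Ioo 0 1 ×ˢ Set.Ioo 0 1) := by
  rintro ⟨x, t⟩ ⟨hx, ht⟩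
  have h1 : 0 < 1 - x := by have := hx.2; simp only at this; linarith
  have := triangleWeight_duffy κ hx ht
  simp only [det_fderivDuffy, smul_eq_mul, abs_of_pos h1, ← this]
  ring

theorem integrableOn_triangle_iff (κ : Fin 3 → ℝ) (F : ℝ × ℝ → ℝ) :
    IntegrableOn (fun p => F p * triangleWeight κ p) triangle ↔
      IntegrableOn (fun q : ℝ × ℝ => F (duffy q) * ((q.1 ^ κ 0 * (1 - q.1) ^ (κ 1 + κ 2 + 1)) *
        (q.2 ^ κ 1 * (1 - q.2) ^ κ 2))) (Set.Ioo 0 1 ×ˢ Set.Ioo 0 1) := by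
  rw [IntegrableOn, restrict_triangle, ← IntegrableOn,
    integrableOn_image_iff_integrableOn_abs_det_fderiv_smul volume
      (measurableSet_Ico.prod measurableSet_Icc)
      (fun q _ => (hasFDerivAt_duffy q).hasFDerivWithinAt) injOn_duffy, IntegrableOn,
    restrict_square, ← IntegrableOn]
  exact integrableOn_congr_fun (setIntegrand_duffy κ F) (measurableSet_Ioo.prod measurableSet_Ioo)

/-- Integration on the triangle against the Jacobi weight. -/
noncomputable def triangleIntegral (κ : Fin 3 → ℝ) (F : ℝ × ℝ → ℝ) : ℝ :=
  ∫ p in triangle, F p * triangleWeight κ p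

theorem triangleIntegral_eq (κ : Fin 3 → ℝ) (F : ℝ × ℝ → ℝ) :
    triangleIntegral κ F =
      ∫ q in (Set.Ioo 0 1 ×ˢ Set.Ioo 0 1 : Set (ℝ × ℝ)), F (duffy q) *
        ((q.1 ^ κ 0 * (1 - q.1) ^ (κ 1 + κ 2 + 1)) * (q.2 ^ κ 1 * (1 - q.2) ^ κ 2)) := by
  rw [triangleIntegral, restrict_triangle,
    integral_image_eq_integral_abs_det_fderiv_smul volume
      (measurableSet_Ico.prod measurableSet_Icc)
      (fun q _ => (hasFDerivAt_duffy q).hasFDerivWithinAt) injOn_duffy, restrict_square]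
  exact setIntegral_congr_fun (measurableSet_Ioo.prod measurableSet_Ioo) (setIntegrand_duffy κ F)

theorem triangleIntegral_mul (κ : Fin 3 → ℝ) {F : ℝ × ℝ → ℝ} {f g : ℝ → ℝ}
    (h : ∀ x t, F (duffy (x, t)) = f x * g t) :
    triangleIntegral κ F =
      jacobiIntegral (κ 1 + κ 2 + 1) (κ 0) f * jacobiIntegral (κ 2) (κ 1) g := by
  rw [triangleIntegral_eq, jacobiIntegral, jacobiIntegral, Measure.volume_eq_prod,
    ← setIntegral_prod_mul]
  refine setIntegral_congr_fun (measurableSet_Ioo.prod measurableSet_Ioo) ?_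
  rintro ⟨x, t⟩ -
  simp only [h]
  ring

theorem isCompact_triangle : IsCompact triangle := by
  refine IsCompact.of_isClosed_subset (isCompact_Icc (a := ((0, 0) : ℝ × ℝ)) (b := (1, 1))) ?_ ?_
  · exact (isClosed_le continuous_const continuous_fst).inter
      ((isClosed_le continuous_const continuous_snd).inter
        (isClosed_le (continuous_fst.add continuous_snd) continuous_const))
  · rintro ⟨x, y⟩ ⟨h1, h2, h3⟩
    simp only at h1 h2 h3
    exact ⟨⟨h1, h2⟩, ⟨by simp only; linarith, by simp only; linarith⟩⟩

theorem integrableOn_triangle {κ : Fin 3 → ℝ} (hκ : ∀ i, -1 < κ i) {F : ℝ × ℝ → ℝ}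
    (hF : Continuous F) : IntegrableOn (fun p => F p * triangleWeight κ p) triangle := by
  refine IntegrableOn.continuousOn_mul hF.continuousOn ?_ isCompact_triangle
  have h := (integrableOn_triangle_iff κ fun _ => 1).mpr ?_
  · simpa using h
  · simp only [one_mul]
    rw [IntegrableOn, Measure.volume_eq_prod, ← Measure.prod_restrict]
    exact (integrableOn_jacobiWeight (by linarith [hκ 1, hκ 2]) (hκ 0)).mul_prod
      (integrableOn_jacobiWeight (hκ 2) (hκ 1))

theorem triangleIntegral_add {κ : Fin 3 → ℝ} (hκ : ∀ i, -1 < κ i) {F G : ℝ × ℝ → ℝ}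
    (hF : Continuous F) (hG : Continuous G) :
    triangleIntegral κ (fun p => F p + G p) = triangleIntegral κ F + triangleIntegral κ G := by
  simp only [triangleIntegral, add_mul]
  exact integral_add (integrableOn_triangle hκ hF) (integrableOn_triangle hκ hG)

theorem triangleIntegral_const_mul (κ : Fin 3 → ℝ) (c : ℝ) (F : ℝ × ℝ → ℝ) :
    triangleIntegral κ (fun p => c * F p) = c * triangleIntegral κ F := by
  simp only [triangleIntegral, mul_assoc, integral_const_mul]

theorem triangleIntegral_sum {κ : Fin 3 → ℝ} (hκ : ∀ i, -1 < κ i) {ι : Type*} (s : Finset ι)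
    (c : ι → ℝ) {F : ι → ℝ × ℝ → ℝ} (hF : ∀ i, Continuous (F i)) :
    triangleIntegral κ (fun p => ∑ i ∈ s, c i * F i p) = ∑ i ∈ s, c i * triangleIntegral κ (F i) := by
  simp only [triangleIntegral, Finset.sum_mul, mul_assoc (c _)]
  rw [integral_finsetSum _ fun i _ => (integrableOn_triangle hκ (hF i)).const_mul _]
  simp_rw [integral_const_mul]

/-! ### Orthogonality and norms of the triangle polynomials -/

theorem homJacobi_mul (n : ℕ) (a b s t : ℝ) :
    homJacobi n a b s (s * t) = s ^ n * jacobi n a b (2 * t - 1) := by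
  rw [homJacobi, jacobi_eval, Finset.mul_sum]
  refine Finset.sum_congr rfl fun k hk => ?_
  have hk' : k ≤ n := Nat.lt_succ_iff.mp (Finset.mem_range.mp hk)
  obtain ⟨r, rfl⟩ := Nat.exists_eq_add_of_le hk'
  rw [Nat.add_sub_cancel_left, show s - s * t = s * (1 - t) by ring, mul_pow, pow_add]
  ring

theorem trianglePoly_duffy (κ : Fin 3 → ℝ) (n j : ℕ) (x t : ℝ) :
    trianglePoly κ n j x ((1 - x) * t) =
      (jacobi (n - j) (κ 1 + κ 2 + 2 * (j : ℝ) + 1) (κ 0) (2 * x - 1) * (1 - x) ^ j) *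
        jacobi j (κ 2) (κ 1) (2 * t - 1) := by
  rw [trianglePoly, homJacobi_mul]; ring

theorem continuous_trianglePoly (κ : Fin 3 → ℝ) (n j : ℕ) :
    Continuous fun p : ℝ × ℝ => trianglePoly κ n j p.1 p.2 := by
  unfold trianglePoly homJacobi jacobi; fun_prop

theorem triangleIntegral_trianglePoly_mul_monomial {κ : Fin 3 → ℝ} (hκ : ∀ i, -1 < κ i)
    {n j a b : ℕ} (hj : j ≤ n) (hab : a + b < n) :
    triangleIntegral κ (fun p => trianglePoly κ n j p.1 p.2 * (p.1 ^ a * p.2 ^ b)) = 0 := by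
  have hA : -1 < κ 1 + κ 2 + 2 * (j : ℝ) + 1 := by
    have : (0 : ℝ) ≤ j := j.cast_nonneg
    linarith [hκ 1, hκ 2]
  rw [triangleIntegral_mul κ
    (f := fun x => jacobi (n - j) (κ 1 + κ 2 + 2 * (j : ℝ) + 1) (κ 0) (2 * x - 1) *
      (1 - x) ^ j * (x ^ a * (1 - x) ^ b))
    (g := fun t => jacobi j (κ 2) (κ 1) (2 * t - 1) * t ^ b)
    (fun x t => by simp only [duffy]; rw [trianglePoly_duffy, mul_pow]; ring)]
  -- If `b < j` the integral over `t` vanishes. Otherwise `(1 - x) ^ (j + b)` supplies `(1 - x) ^ (2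
  -- * j)`, which shifts the weight to the one of the first Jacobi factor, and the remaining degree
  -- `a + b - j` is below `n - j`.
  rcases lt_or_ge b j with hb | hb
  · have := jacobiIntegral_jacobi_mul_eq_zero (hκ 2) (hκ 1) (n := j) (p := Polynomial.X ^ b)
      (by simpa using hb)
    simp only [Polynomial.eval_pow, Polynomial.eval_X] at this
    rw [this, mul_zero]
  · obtain ⟨d, rfl⟩ := Nat.exists_eq_add_of_le hb
    have h1 := jacobiIntegral_mul_pow (κ 1 + κ 2 + 1) (κ 0)
      (fun x => jacobi (n - j) (κ 1 + κ 2 + 2 * (j : ℝ) + 1) (κ 0) (2 * x - 1) *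
        (Polynomial.X ^ a * (1 - Polynomial.X) ^ d : Polynomial ℝ).eval x) (2 * j) 0
    rw [show κ 1 + κ 2 + 1 + ((2 * j : ℕ) : ℝ) = κ 1 + κ 2 + 2 * (j : ℝ) + 1 by push_cast; ring,
      Nat.cast_zero, add_zero, jacobiIntegral_jacobi_mul_eq_zero hA (hκ 0)] at h1
    · have h2 : (fun x => jacobi (n - j) (κ 1 + κ 2 + 2 * (j : ℝ) + 1) (κ 0) (2 * x - 1) *
          (1 - x) ^ j * (x ^ a * (1 - x) ^ (j + d))) =
          fun x => jacobi (n - j) (κ 1 + κ 2 + 2 * (j : ℝ) + 1) (κ 0) (2 * x - 1) *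
        (Polynomial.X ^ a * (1 - Polynomial.X) ^ d : Polynomial ℝ).eval x *
          ((1 - x) ^ (2 * j) * x ^ 0) := by
        funext x
        simp only [Polynomial.eval_mul, Polynomial.eval_pow, Polynomial.eval_X,
          Polynomial.eval_sub, Polynomial.eval_one]
        ring
      rw [h2, h1, zero_mul]
    · have := Polynomial.natDegree_mul_le_of_le (Polynomial.natDegree_X_pow_le (R := ℝ) a)
        (natDegree_one_sub_X_pow_le d)
      omega

theorem triangleIntegral_trianglePoly_mul {κ : Fin 3 → ℝ} (n j m : ℕ) :
    triangleIntegral κ (fun p => trianglePoly κ n j p.1 p.2 * trianglePoly κ n m p.1 p.2) =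
      jacobiIntegral (κ 1 + κ 2 + 1) (κ 0) (fun x =>
        jacobi (n - j) (κ 1 + κ 2 + 2 * (j : ℝ) + 1) (κ 0) (2 * x - 1) * (1 - x) ^ j *
        (jacobi (n - m) (κ 1 + κ 2 + 2 * (m : ℝ) + 1) (κ 0) (2 * x - 1) * (1 - x) ^ m)) *
      jacobiIntegral (κ 2) (κ 1) (fun t =>
        jacobi j (κ 2) (κ 1) (2 * t - 1) * jacobi m (κ 2) (κ 1) (2 * t - 1)) :=
  triangleIntegral_mul κ fun x t => by
    simp only [duffy]; rw [trianglePoly_duffy, trianglePoly_duffy]; ring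

theorem triangleIntegral_trianglePoly_of_ne {κ : Fin 3 → ℝ} (hκ : ∀ i, -1 < κ i)
    {n j m : ℕ} (h : j ≠ m) :
    triangleIntegral κ (fun p => trianglePoly κ n j p.1 p.2 * trianglePoly κ n m p.1 p.2) = 0 := by
  wlog hlt : m < j generalizing j m
  · have := this h.symm (by omega)
    simp_rw [mul_comm] at this ⊢
    exact this
  have := jacobiIntegral_jacobi_mul_eq_zero (hκ 2) (hκ 1) (n := j)
    (p := jacobiPolynomial m (κ 2) (κ 1)) ((jacobiPolynomial_natDegree_le _ _ _).trans_lt hlt)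
  simp_rw [jacobiPolynomial_eval] at this
  rw [triangleIntegral_trianglePoly_mul, this, mul_zero]

theorem triangleIntegral_trianglePoly_sq {κ : Fin 3 → ℝ} (hκ : ∀ i, -1 < κ i) (n m : ℕ) :
    triangleIntegral κ (fun p => trianglePoly κ n m p.1 p.2 * trianglePoly κ n m p.1 p.2) =
      jacobiNormSq (n - m) (κ 1 + κ 2 + 2 * (m : ℝ) + 1) (κ 0) * jacobiNormSq m (κ 2) (κ 1) := by
  have hA : -1 < κ 1 + κ 2 + 2 * (m : ℝ) + 1 := by
    have : (0 : ℝ) ≤ m := m.cast_nonneg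
    linarith [hκ 1, hκ 2]
  rw [triangleIntegral_trianglePoly_mul, jacobiIntegral_jacobi_sq (hκ 2) (hκ 1),
    ← jacobiIntegral_jacobi_sq hA (hκ 0)]
  have h1 := jacobiIntegral_mul_pow (κ 1 + κ 2 + 1) (κ 0)
      (fun x => jacobi (n - m) (κ 1 + κ 2 + 2 * (m : ℝ) + 1) (κ 0) (2 * x - 1) *
        jacobi (n - m) (κ 1 + κ 2 + 2 * (m : ℝ) + 1) (κ 0) (2 * x - 1)) (2 * m) 0
  rw [show κ 1 + κ 2 + 1 + ((2 * m : ℕ) : ℝ) = κ 1 + κ 2 + 2 * (m : ℝ) + 1 by push_cast; ring,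
      Nat.cast_zero, add_zero] at h1
  rw [← h1]
  congr 2
  funext x
  ring

theorem jacobiNormSq_pos {a b : ℝ} (ha : -1 < a) (hb : -1 < b) (n : ℕ) : 0 < jacobiNormSq n a b := by
  have h1 : 0 < poch (n + a + b + 1) n := by
    -- For `n = 0` the base `a + b + 1` may be negative or zero, but the product is empty.
    rcases n with _ | n
    · simp [poch_zero]
    · refine poch_pos ?_ _
      have : (0 : ℝ) ≤ n := n.cast_nonneg
      push_cast; linarith
  have h2 := poch_pos (a := a + 1) (by linarith) n
  have h3 := poch_pos (a := b + 1) (by linarith) n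
  have h4 := poch_pos (a := a + b + 2) (by linarith) (2 * n)
  have h5 := jacobiMass_pos ha hb
  unfold jacobiNormSq
  positivity

/-- The constant that normalizes the Jacobi weight on the triangle. -/
noncomputable def triangleConst (κ : Fin 3 → ℝ) : ℝ :=
  Real.Gamma (κ 0 + κ 1 + κ 2 + 3) /
      (Real.Gamma (κ 0 + 1) * Real.Gamma (κ 1 + 1) * Real.Gamma (κ 2 + 1))

theorem triangleConst_pos {κ : Fin 3 → ℝ} (hκ : ∀ i, -1 < κ i) : 0 < triangleConst κ := by
  have h : ∀ i, 0 < Real.Gamma (κ i + 1) := fun i => Real.Gamma_pos_of_pos (by linarith [hκ i])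
  exact div_pos (Real.Gamma_pos_of_pos (by linarith [hκ 0, hκ 1, hκ 2]))
    (mul_pos (mul_pos (h 0) (h 1)) (h 2))

theorem triangleNormSq_eq (κ : Fin 3 → ℝ) (n m : ℕ) :
    triangleNormSq κ n m = triangleConst κ * triangleIntegral κ
      (fun p => trianglePoly κ n m p.1 p.2 * trianglePoly κ n m p.1 p.2) := rfl

theorem triangleNormSq_pos {κ : Fin 3 → ℝ} (hκ : ∀ i, -1 < κ i) (n m : ℕ) :
    0 < triangleNormSq κ n m := by
  rw [triangleNormSq_eq, triangleIntegral_trianglePoly_sq hκ]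
  have : (0 : ℝ) ≤ m := m.cast_nonneg
  exact mul_pos (triangleConst_pos hκ) (mul_pos
    (jacobiNormSq_pos (by linarith [hκ 1, hκ 2]) (hκ 0) _) (jacobiNormSq_pos (hκ 2) (hκ 1) _))

theorem triangleIntegral_swap (κ : Fin 3 → ℝ) (F : ℝ × ℝ → ℝ) :
    triangleIntegral (permAct (Equiv.swap 0 1) κ) F = triangleIntegral κ (fun p => F p.swap) := by
  have h : triangle = Prod.swap ⁻¹' triangle := by
    ext ⟨x, y⟩
    simp only [triangle, Set.mem_ofPred_eq, Set.mem_preimage, Prod.swap]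
    rw [add_comm]; tauto
  have h0 : permAct (Equiv.swap 0 1) κ 0 = κ 1 := by simp [permAct]
  have h1 : permAct (Equiv.swap 0 1) κ 1 = κ 0 := by simp [permAct]
  have h2 : permAct (Equiv.swap 0 1) κ 2 = κ 2 := by
    rw [permAct, Equiv.swap_apply_of_ne_of_ne (by decide) (by decide)]
  unfold triangleIntegral
  have hs : MeasurePreserving (Prod.swap : ℝ × ℝ → ℝ × ℝ) := Measure.measurePreserving_swap
  rw [← hs.setIntegral_preimage_emb MeasurableEquiv.prodComm.measurableEmbedding, ← h]
  refine integral_congr_ae (Filter.Eventually.of_forall fun p => ?_)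
  simp only [triangleWeight, h0, h1, h2, Prod.fst_swap, Prod.snd_swap]
  ring_nf

/-! ### Polynomials of bounded degree and restriction to an edge -/

/-- Polynomial functions of total degree less than `n` in two variables. -/
def polyDegLT (n : ℕ) : Submodule ℝ (ℝ × ℝ → ℝ) :=
  Submodule.span ℝ {f | ∃ a b : ℕ, a + b < n ∧ f = fun p => p.1 ^ a * p.2 ^ b}

theorem monomial_mem_polyDegLT {n a b : ℕ} (h : a + b < n) :
    (fun p : ℝ × ℝ => p.1 ^ a * p.2 ^ b) ∈ polyDegLT n :=
  Submodule.subset_span ⟨a, b, h, rfl⟩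

theorem polyDegLT_mono {m n : ℕ} (h : m ≤ n) : polyDegLT m ≤ polyDegLT n := by
  refine Submodule.span_mono ?_
  rintro f ⟨a, b, hab, rfl⟩
  exact ⟨a, b, hab.trans_le h, rfl⟩

theorem mul_mem_polyDegLT {m n : ℕ} {f g : ℝ × ℝ → ℝ} (hf : f ∈ polyDegLT (m + 1))
    (hg : g ∈ polyDegLT (n + 1)) : f * g ∈ polyDegLT (m + n + 1) := by
  have h := Submodule.mul_mem_mul hf hg
  rw [polyDegLT, polyDegLT, Submodule.span_mul_span] at h
  refine Submodule.span_mono ?_ h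
  rintro _ ⟨_, ⟨a, b, hab, rfl⟩, _, ⟨c, d, hcd, rfl⟩, rfl⟩
  refine ⟨a + c, b + d, by omega, ?_⟩
  funext p
  simp only [Pi.mul_apply]
  ring

theorem const_mem_polyDegLT (c : ℝ) (n : ℕ) : (fun _ : ℝ × ℝ => c) ∈ polyDegLT (n + 1) := by
  have := (polyDegLT (n + 1)).smul_mem c (monomial_mem_polyDegLT (a := 0) (b := 0) (by omega))
  convert this using 1
  funext p; simp

theorem pow_mem_polyDegLT {f : ℝ × ℝ → ℝ} (hf : f ∈ polyDegLT 2) (k : ℕ) :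
    f ^ k ∈ polyDegLT (k + 1) := by
  induction k with
  | zero => exact const_mem_polyDegLT 1 0
  | succ k ih => rw [pow_succ]; exact mul_mem_polyDegLT ih hf

theorem fst_mem_polyDegLT : (Prod.fst : ℝ × ℝ → ℝ) ∈ polyDegLT 2 := by
  simpa using monomial_mem_polyDegLT (n := 2) (a := 1) (b := 0) (by norm_num)

theorem snd_mem_polyDegLT : (Prod.snd : ℝ × ℝ → ℝ) ∈ polyDegLT 2 := by
  simpa using monomial_mem_polyDegLT (n := 2) (a := 0) (b := 1) (by norm_num)

theorem one_sub_fst_mem_polyDegLT : (fun p : ℝ × ℝ => 1 - p.1) ∈ polyDegLT 2 :=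
  (polyDegLT 2).sub_mem (const_mem_polyDegLT 1 1) fst_mem_polyDegLT

theorem one_sub_fst_sub_snd_mem_polyDegLT : (fun p : ℝ × ℝ => 1 - p.1 - p.2) ∈ polyDegLT 2 :=
  (polyDegLT 2).sub_mem one_sub_fst_mem_polyDegLT snd_mem_polyDegLT

theorem comp_swap_mem_polyDegLT {n : ℕ} {f : ℝ × ℝ → ℝ} (hf : f ∈ polyDegLT n) :
    (fun p => f p.swap) ∈ polyDegLT n := by
  induction hf using Submodule.span_induction with
  | mem f hf =>
    obtain ⟨a, b, hab, rfl⟩ := hf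
    simp only [Prod.fst_swap, Prod.snd_swap]
    simp_rw [mul_comm]
    exact monomial_mem_polyDegLT (by omega)
  | zero => exact (polyDegLT n).zero_mem
  | add f g _ _ hf hg => exact (polyDegLT n).add_mem hf hg
  | smul c f _ hf => exact (polyDegLT n).smul_mem c hf

theorem analyticOnNhd_of_mem_polyDegLT {n : ℕ} {f : ℝ × ℝ → ℝ} (hf : f ∈ polyDegLT n) :
    AnalyticOnNhd ℝ f Set.univ := by
  induction hf using Submodule.span_induction with
  | mem f hf =>
    obtain ⟨a, b, hab, rfl⟩ := hf
    exact (analyticOnNhd_fst.pow a).mul (analyticOnNhd_snd.pow b)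
  | zero => exact analyticOnNhd_const
  | add f g _ _ hf hg => exact hf.add hg
  | smul c f _ hf => exact (analyticOnNhd_const (v := c)).mul hf

theorem continuous_of_mem_polyDegLT {n : ℕ} {f : ℝ × ℝ → ℝ} (hf : f ∈ polyDegLT n) :
    Continuous f :=
  continuousOn_univ.mp (analyticOnNhd_of_mem_polyDegLT hf).continuousOn

theorem trianglePoly_mem_polyDegLT (κ : Fin 3 → ℝ) {n j : ℕ} (hj : j ≤ n) :
    (fun p : ℝ × ℝ => trianglePoly κ n j p.1 p.2) ∈ polyDegLT (n + 1) := by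
  obtain ⟨r, rfl⟩ := Nat.exists_eq_add_of_le' hj
  refine mul_mem_polyDegLT (f := fun p => jacobi (r + j - j) _ _ (2 * p.1 - 1))
    (g := fun p => homJacobi j _ _ (1 - p.1) p.2) ?_ ?_
  · rw [Nat.add_sub_cancel]
    have : (fun p : ℝ × ℝ => jacobi r (κ 1 + κ 2 + 2 * (j : ℝ) + 1) (κ 0) (2 * p.1 - 1)) =
        ∑ k ∈ range (r + 1), jacobiCoeff r (κ 1 + κ 2 + 2 * (j : ℝ) + 1) (κ 0) k •
          (fun p : ℝ × ℝ => 1 - p.1) ^ k := by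
      funext p
      simp [jacobi_eval]
    rw [this]
    refine Submodule.sum_mem _ fun k hk => Submodule.smul_mem _ _ ?_
    have := mem_range.mp hk
    exact polyDegLT_mono (by omega) (pow_mem_polyDegLT one_sub_fst_mem_polyDegLT k)
  · have : (fun p : ℝ × ℝ => homJacobi j (κ 2) (κ 1) (1 - p.1) p.2) =
        ∑ k ∈ range (j + 1), jacobiCoeff j (κ 2) (κ 1) k •
          ((fun p : ℝ × ℝ => 1 - p.1 - p.2) ^ k * (fun p : ℝ × ℝ => 1 - p.1) ^ (j - k)) := by
      funext p
      simp [homJacobi, mul_assoc]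
    rw [this]
    refine Submodule.sum_mem _ fun k hk => Submodule.smul_mem _ _ ?_
    have := mem_range.mp hk
    exact polyDegLT_mono (by omega) (mul_mem_polyDegLT
      (pow_mem_polyDegLT one_sub_fst_sub_snd_mem_polyDegLT k)
      (pow_mem_polyDegLT one_sub_fst_mem_polyDegLT (j - k)))

/-- Division with remainder by `1 - x - y`. -/
theorem exists_quotient_of_mem_polyDegLT {n : ℕ} {f : ℝ × ℝ → ℝ} (hf : f ∈ polyDegLT (n + 1)) :
    ∃ q ∈ polyDegLT n, ∀ p, f p = f (p.1, 1 - p.1) + (1 - p.1 - p.2) * q p := by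
  induction hf using Submodule.span_induction with
  | mem f hf =>
    obtain ⟨a, b, hab, rfl⟩ := hf
    -- The quotient comes from factoring `y ^ b - (1 - x) ^ b` by `y - (1 - x)`.
    refine ⟨-∑ i ∈ range b, (fun p : ℝ × ℝ => p.1 ^ a * p.2 ^ i) *
      (fun p : ℝ × ℝ => 1 - p.1) ^ (b - 1 - i), ?_, fun p => ?_⟩
    · refine Submodule.neg_mem _ (Submodule.sum_mem _ fun i hi => ?_)
      have := mem_range.mp hi
      refine polyDegLT_mono ?_ (mul_mem_polyDegLT (m := a + i)
        (monomial_mem_polyDegLT (by omega))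
        (pow_mem_polyDegLT one_sub_fst_mem_polyDegLT (b - 1 - i)))
      omega
    · have := Commute.geom_sum₂_mul (Commute.all p.2 (1 - p.1)) b
      simp only [Pi.neg_apply, Finset.sum_apply, Pi.mul_apply, Pi.pow_apply, mul_assoc,
        ← Finset.mul_sum]
      linear_combination -(p.1 ^ a) * this
  | zero => exact ⟨0, Submodule.zero_mem _, by simp⟩
  | add f g _ _ hf hg =>
    obtain ⟨q, hq, h⟩ := hf
    obtain ⟨q', hq', h'⟩ := hg
    refine ⟨q + q', Submodule.add_mem _ hq hq', fun p => ?_⟩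
    simp only [Pi.add_apply]
    linear_combination h p + h' p
  | smul c f _ hf =>
    obtain ⟨q, hq, h⟩ := hf
    refine ⟨c • q, Submodule.smul_mem _ c hq, fun p => ?_⟩
    simp only [Pi.smul_apply, smul_eq_mul]
    linear_combination c * h p

theorem triangleIntegral_mul_eq_zero {κ : Fin 3 → ℝ} (hκ : ∀ i, -1 < κ i) {n : ℕ}
    {D q : ℝ × ℝ → ℝ} (hD : Continuous D)
    (h : ∀ a b : ℕ, a + b < n → triangleIntegral κ (fun p => D p * (p.1 ^ a * p.2 ^ b)) = 0)
    (hq : q ∈ polyDegLT n) : triangleIntegral κ (fun p => D p * q p) = 0 := by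
  induction hq using Submodule.span_induction with
  | mem f hf =>
    obtain ⟨a, b, hab, rfl⟩ := hf
    exact h a b hab
  | zero => simp [triangleIntegral]
  | add f g hf hg hf' hg' =>
    simp only [Pi.add_apply, mul_add]
    rw [triangleIntegral_add hκ (F := fun p => D p * f p) (G := fun p => D p * g p)
      (hD.mul (continuous_of_mem_polyDegLT hf)) (hD.mul (continuous_of_mem_polyDegLT hg)),
      hf', hg', add_zero]
  | smul c f _ hf =>
    simp only [Pi.smul_apply, smul_eq_mul, mul_left_comm _ c]
    rw [triangleIntegral_const_mul, hf, mul_zero]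

/-- A polynomial of degree at most `n` that is orthogonal to all polynomials of lower degree is
determined by its values on the edge `x + y = 1`. -/
theorem eq_zero_of_orthogonal_of_edge {κ : Fin 3 → ℝ} (hκ : ∀ i, -1 < κ i) {n : ℕ}
    {D : ℝ × ℝ → ℝ} (hD : D ∈ polyDegLT (n + 1))
    (h : ∀ a b : ℕ, a + b < n → triangleIntegral κ (fun p => D p * (p.1 ^ a * p.2 ^ b)) = 0)
    (hedge : ∀ t, D (t, 1 - t) = 0) : D = 0 := by
  obtain ⟨q, hq, hDq⟩ := exists_quotient_of_mem_polyDegLT hD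
  simp only [hedge, zero_add] at hDq
  have hqc := continuous_of_mem_polyDegLT hq
  -- Pair `D = (1 - x - y) * q` with `q` itself: the integrand becomes nonnegative, so it vanishes
  -- almost everywhere on the triangle.
  have h0 := triangleIntegral_mul_eq_zero hκ (continuous_of_mem_polyDegLT hD) h hq
  have hmeas : MeasurableSet triangle := isCompact_triangle.measurableSet
  have hnonneg : 0 ≤ᵐ[volume.restrict triangle]
      fun p => D p * q p * triangleWeight κ p := by
    refine ae_restrict_of_forall_mem hmeas ?_
    rintro ⟨x, y⟩ ⟨h1, h2, h3⟩
    simp only [Pi.zero_apply, hDq, triangleWeight] at *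
    have h4 : 0 ≤ 1 - x - y := by linarith
    rw [mul_assoc (1 - x - y)]
    have := mul_self_nonneg (q (x, y))
    have := Real.rpow_nonneg h1 (κ 0)
    have := Real.rpow_nonneg h2 (κ 1)
    have := Real.rpow_nonneg h4 (κ 2)
    positivity
  have hae := (setIntegral_eq_zero_iff_of_nonneg_ae hnonneg (integrableOn_triangle hκ
    ((continuous_of_mem_polyDegLT hD).mul hqc))).mp h0
  set U : Set (ℝ × ℝ) := {p | 0 < p.1 ∧ 0 < p.2 ∧ p.1 + p.2 < 1} with hU
  have hUo : IsOpen U := (isOpen_lt continuous_const continuous_fst).inter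
    ((isOpen_lt continuous_const continuous_snd).inter
      (isOpen_lt (continuous_fst.add continuous_snd) continuous_const))
  have hUt : U ⊆ triangle := fun p hp => ⟨hp.1.le, hp.2.1.le, hp.2.2.le⟩
  have hae' : q =ᵐ[volume.restrict U] fun _ => 0 := by
    filter_upwards [ae_restrict_of_ae_restrict_of_subset hUt hae,
      ae_restrict_mem hUo.measurableSet] with p hp hpU
    have h1 := Real.rpow_pos_of_pos hpU.1 (κ 0)
    have h2 := Real.rpow_pos_of_pos hpU.2.1 (κ 1)
    have h4 : 0 < 1 - p.1 - p.2 := by linarith [hpU.2.2]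
    have h3 := Real.rpow_pos_of_pos h4 (κ 2)
    simp only [Pi.zero_apply, hDq, triangleWeight] at hp
    by_contra hne
    refine absurd hp (mul_ne_zero (mul_ne_zero (mul_ne_zero h4.ne' hne) hne) ?_)
    positivity
  have hzero := Measure.eqOn_open_of_ae_eq hae' hUo hqc.continuousOn continuousOn_const
  have hq0 : q = fun _ => 0 := by
    -- A polynomial function that is zero on the open triangle is zero everywhere, by analytic
    -- continuation.
    refine AnalyticOnNhd.eq_of_eventuallyEq (𝕜 := ℝ) (z₀ := (1 / 4, 1 / 4))
      (analyticOnNhd_of_mem_polyDegLT hq) analyticOnNhd_const ?_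
    exact Filter.eventually_of_mem (hUo.mem_nhds (by norm_num [hU])) hzero
  funext p
  rw [hDq, hq0, mul_zero]
  rfl

/-! ### The hypergeometric identity behind the connection coefficients -/

theorem sum_antidiagonal_shift (f : ℕ → ℕ → ℝ) (i M : ℕ) (hf : ∀ m k, m < i → f m k = 0) :
    ∑ p ∈ antidiagonal (i + M), f p.1 p.2 = ∑ p ∈ antidiagonal M, f (i + p.1) p.2 := by
  induction i generalizing f with
  | zero => simp
  | succ i ih =>
    rw [add_right_comm, Finset.Nat.sum_antidiagonal_succ, hf 0 _ (Nat.succ_pos i), zero_add,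
      ih (fun m k => f (m + 1) k) fun m k h => hf _ _ (by omega)]
    simp only [add_right_comm]

theorem hyp4F3_eq_sum {m N : ℕ} (h : m ≤ N) (b c d e f g : ℝ) :
    hyp4F3 (-(m : ℝ)) b c d e f g 1 = ∑ i ∈ range (N + 1),
      (poch (-(m : ℝ)) i * poch b i * poch c i * poch d i) /
        (poch e i * poch f i * poch g i * (i.factorial : ℝ)) := by
  unfold hyp4F3
  rw [tsum_eq_sum (s := range (N + 1))]
  · simp
  · intro k hk
    rw [poch_neg_natCast_eq_zero (by simp only [mem_range] at hk; omega)]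
    simp

/-- Both sides come from splitting `(-R - N)_{N+j}` after `N` factors and after `j` factors. -/
theorem poch_neg_natCast_mul_poch (R N j : ℕ) :
    poch (-((R + N : ℕ) : ℝ)) j * R.factorial * poch (R + 1 - j) N =
      (R + N).factorial * poch (-(R : ℝ)) j := by
  have h1 := poch_add (-((R + N : ℕ) : ℝ)) N j
  have h2 := poch_add (-((R + N : ℕ) : ℝ)) j N
  have h3 := poch_neg_natCast_mul R N
  have h4 := poch_neg ((R : ℝ) - j) N
  rw [show -((R + N : ℕ) : ℝ) + N = -(R : ℝ) by push_cast; ring] at h1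
  rw [show -((R + N : ℕ) : ℝ) + j = -((R : ℝ) - j) - N by push_cast; ring, h4,
    add_comm j N, h1, show (R : ℝ) - j + 1 = R + 1 - j by ring] at h2
  have h5 : ((-1 : ℝ) ^ N) * (-1) ^ N = 1 := by rw [← mul_pow]; simp
  linear_combination (-(-1) ^ N * R.factorial) * h2 + (-1) ^ N * poch (-(R : ℝ)) j * h3 +
    ((R + N).factorial * poch (-(R : ℝ)) j -
      poch (-((R + N : ℕ) : ℝ)) j * R.factorial * poch (R + 1 - j) N) * h5

theorem factorial_div_mul_choose (i M : ℕ) :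
    ((i + M).factorial : ℝ) / M.factorial = ((i + M).choose i : ℝ) * i.factorial := by
  have h : ((i + M).choose i : ℝ) * i.factorial * M.factorial = (i + M).factorial := by
    rw [Nat.choose_symm_add]; exact_mod_cast Nat.add_choose_mul_factorial_mul_factorial i M
  have : (M.factorial : ℝ) ≠ 0 := by positivity
  field_simp
  linear_combination -h

theorem choose_mul_poch_neg (i l k : ℕ) :
    ((i + (l + k)).choose (i + l) : ℝ) * poch (-((i + l : ℕ) : ℝ)) i =
      (-1) ^ i * ((i + (l + k)).factorial / (l + k).factorial) * (l + k).choose l := by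
  have h1 := poch_neg_natCast_mul l i
  have h2 := factorial_div_mul_choose (i + l) k
  have h3 := factorial_div_mul_choose l k
  have : (l.factorial : ℝ) ≠ 0 := by positivity
  have : (k.factorial : ℝ) ≠ 0 := by positivity
  have : ((l + k).factorial : ℝ) ≠ 0 := by positivity
  rw [add_comm l i] at h1
  rw [add_assoc] at h2
  field_simp at h2 h3 ⊢
  apply mul_left_cancel₀ ‹(l.factorial : ℝ) ≠ 0›
  rw [h2, h3]
  linear_combination (((i + (l + k)).choose (i + l) : ℝ) * (l.factorial * k.factorial * (l + k).choose l)) * h1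

/-- The factor `(m + s)_i` of the `₄F₃`, taken at `m = i + l`, turns the well-poised parameter `s`
into `s + 2 * i`; hence the inner sum is again very-well-poised. -/
theorem poch_mul_wellPoisedWeight {s : ℝ} (hs : -1 < s) (i l k : ℕ) :
    poch (((i + l : ℕ) : ℝ) + s) i * wellPoisedWeight s (i + l) k =
      wellPoisedWeight (s + 2 * i) l k := by
  have h : poch (s + (i + l : ℕ)) (i + l) =
      poch (((i + l : ℕ) : ℝ) + s) i * poch (s + 2 * i + l) l := by
    rw [poch_add, add_comm s]; push_cast; ring_nf
  have h0 : poch (((i + l : ℕ) : ℝ) + s) i ≠ 0 := by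
    rcases i with _ | i
    · simp [poch_zero]
    · refine (poch_pos ?_ _).ne'
      have : (0 : ℝ) ≤ i := i.cast_nonneg
      have : (0 : ℝ) ≤ l := l.cast_nonneg
      push_cast; linarith
  rw [wellPoisedWeight, wellPoisedWeight, h,
    show s + 2 * ((i + l : ℕ) : ℝ) + 1 = s + 2 * i + 2 * l + 1 by push_cast; ring, mul_assoc,
    mul_inv, mul_inv_cancel_left₀ h0]

/-- Terms with `m < i` vanish. With `m = i + l` and `S = n + |κ| + 2`, where `n = i + M + R`, the
rest is the very-well-poised sum with parameters `a = β + γ + 1 + 2i`, `b = γ + 1 + i`, `c = S + i`.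
-/
theorem sum_connection_inner {β γ : ℝ} (hβ : -1 < β) (hγ : -1 < γ) (α : ℝ)
    (hs : -1 < β + γ + 1) (i M R : ℕ) :
    ∑ p ∈ antidiagonal (i + M), ((i + M).choose p.1 : ℝ) *
      (poch (γ + 1) p.1 * poch ((i + M + R : ℕ) + (α + β + γ) + 2) p.1 * poch (β + 1 + p.1) p.2 *
        poch (α + R + 1) p.2 * wellPoisedWeight (β + γ + 1) p.1 p.2 *
        (poch (-(p.1 : ℝ)) i * poch (p.1 + β + γ + 1) i)) =
      (-1) ^ i * ((i + M).factorial / M.factorial) *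
        (poch (γ + 1) i * poch ((i + M + R : ℕ) + (α + β + γ) + 2) i *
          poch (R + α + γ + 2 + i) M) := by
  set S : ℝ := (i + M + R : ℕ) + (α + β + γ) + 2 with hS
  rw [sum_antidiagonal_shift (fun m k => ((i + M).choose m : ℝ) *
      (poch (γ + 1) m * poch S m * poch (β + 1 + m) k *
        poch (α + R + 1) k * wellPoisedWeight (β + γ + 1) m k *
        (poch (-(m : ℝ)) i * poch (m + β + γ + 1) i)))]
  swap
  · intro m k h; rw [poch_neg_natCast_eq_zero h]; ring
  have hi : (0 : ℝ) ≤ i := i.cast_nonneg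
  have hV := sum_choose_wellPoised (a := β + γ + 1 + 2 * i) (by linarith) (γ + 1 + i) (S + i) M
  have h1 : poch (1 + (β + γ + 1 + 2 * i) - (γ + 1 + i) - (S + i)) M =
      (-1) ^ M * poch (R + α + γ + 2 + i) M := by
    have := poch_neg ((R : ℝ) + α + γ + 1 + i) M
    rw [show (R : ℝ) + α + γ + 1 + i + 1 = R + α + γ + 2 + i by ring] at this
    rw [← this, hS]; congr 1; push_cast; ring
  have h2 : poch (R + α + γ + 2 + i) M = (-1) ^ M * ∑ p ∈ antidiagonal M, (M.choose p.1 : ℝ) *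
      ((-1) ^ p.1 * poch (γ + 1 + i) p.1 * poch (S + i) p.1 *
        poch (1 + (β + γ + 1 + 2 * i) - (γ + 1 + i) + p.1) p.2 *
        poch (1 + (β + γ + 1 + 2 * i) - (S + i) + p.1) p.2 *
        wellPoisedWeight (β + γ + 1 + 2 * i) p.1 p.2) := by
    rw [hV, h1, ← mul_assoc, ← mul_pow]; simp
  rw [h2, Finset.mul_sum, Finset.mul_sum, Finset.mul_sum]
  refine Finset.sum_congr rfl ?_
  rintro ⟨l, k⟩ hp
  obtain rfl := HasAntidiagonal.mem_antidiagonal.mp hp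
  have h3 : poch (1 + (β + γ + 1 + 2 * i) - (S + i) + l) k = (-1) ^ k * poch (α + R + 1) k := by
    rw [← poch_neg, hS]; congr 1; push_cast; ring
  have h4 : ((-1 : ℝ) ^ (l + k)) * ((-1) ^ l * (-1) ^ k) = 1 := by
    rw [← pow_add, ← pow_add, Even.neg_one_pow ⟨l + k, rfl⟩]
  have h5 := choose_mul_poch_neg i l k
  have h6 := poch_mul_wellPoisedWeight hs i l k
  have h7 : poch (β + 1 + ((i + l : ℕ) : ℝ)) k = poch (1 + (β + γ + 1 + 2 * i) - (γ + 1 + i) + l) k := by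
    congr 1; push_cast; ring
  simp only
  rw [h3, poch_add (γ + 1), poch_add S, h7, ← h6,
    show ((i + l : ℕ) : ℝ) + β + γ + 1 = (i + l : ℕ) + (β + γ + 1) by ring]
  set A := poch (((i + l : ℕ) : ℝ) + (β + γ + 1)) i * wellPoisedWeight (β + γ + 1) (i + l) k
  set B := poch (γ + 1) i * poch (γ + 1 + i) l * (poch S i * poch (S + i) l) *
    poch (1 + (β + γ + 1 + 2 * i) - (γ + 1 + i) + l) k * poch (α + R + 1) k * A
  linear_combination B * h5 - (-1) ^ i * ((i + (l + k)).factorial / (l + k).factorial) *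
    (l + k).choose l * B * h4

theorem poch_degree_pos {α β γ : ℝ} (hα : -1 < α) (hβ : -1 < β) (hγ : -1 < γ) {n i : ℕ}
    (h : i ≤ n) : 0 < poch (n + (α + β + γ) + 2) i := by
  rcases i with _ | i
  · simp [poch_zero]
  · refine poch_pos ?_ _
    have : (1 : ℝ) ≤ n := by exact_mod_cast (by omega : 1 ≤ n)
    linarith

/-- Expand the `₄F₃` over `i` and sum over `m` first, by `sum_connection_inner`. What remains over
`i` is balanced and is summed by Pfaff–Saalschütz with upper parameters `-j` and `j + α + γ + 1`. -/
theorem sum_connection {α β γ : ℝ} (hα : -1 < α) (hβ : -1 < β) (hγ : -1 < γ) (N R j : ℕ) :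
    poch (-((N + R : ℕ) : ℝ)) j * ∑ p ∈ antidiagonal N, (N.choose p.1 : ℝ) *
      (poch (γ + 1) p.1 * poch ((N + R : ℕ) + (α + β + γ) + 2) p.1 * poch (β + 1 + p.1) p.2 *
        poch (α + R + 1) p.2 * wellPoisedWeight (β + γ + 1) p.1 p.2 *
        hyp4F3 (-(p.1 : ℝ)) (p.1 + β + γ + 1) (-(j : ℝ)) (j + α + γ + 1)
          (-((N + R : ℕ) : ℝ)) (γ + 1) ((N + R : ℕ) + (α + β + γ) + 2) 1) =
      poch (-(R : ℝ)) j * poch (α + γ + j + 2 + R) N := by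
  set S : ℝ := (N + R : ℕ) + (α + β + γ) + 2 with hS
  have e1 : ∀ p ∈ antidiagonal N, (N.choose p.1 : ℝ) *
      (poch (γ + 1) p.1 * poch S p.1 * poch (β + 1 + p.1) p.2 *
        poch (α + R + 1) p.2 * wellPoisedWeight (β + γ + 1) p.1 p.2 *
        hyp4F3 (-(p.1 : ℝ)) (p.1 + β + γ + 1) (-(j : ℝ)) (j + α + γ + 1)
          (-((N + R : ℕ) : ℝ)) (γ + 1) S 1) =
      ∑ i ∈ range (N + 1), (poch (-(j : ℝ)) i * poch (j + α + γ + 1) i /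
        (poch (-((N + R : ℕ) : ℝ)) i * poch (γ + 1) i * poch S i * i.factorial)) *
        ((N.choose p.1 : ℝ) *
      (poch (γ + 1) p.1 * poch S p.1 * poch (β + 1 + p.1) p.2 *
        poch (α + R + 1) p.2 * wellPoisedWeight (β + γ + 1) p.1 p.2 *
        (poch (-(p.1 : ℝ)) i * poch (p.1 + β + γ + 1) i))) := by
    intro p hp
    have := HasAntidiagonal.mem_antidiagonal.mp hp
    rw [hyp4F3_eq_sum (N := N) (by omega), Finset.mul_sum, Finset.mul_sum]
    refine Finset.sum_congr rfl fun i _ => ?_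
    ring
  rw [Finset.sum_congr rfl e1, Finset.sum_comm]
  simp_rw [← Finset.mul_sum]
  have e2 : ∀ p ∈ antidiagonal N, (poch (-(j : ℝ)) p.1 * poch (j + α + γ + 1) p.1 /
        (poch (-((N + R : ℕ) : ℝ)) p.1 * poch (γ + 1) p.1 * poch S p.1 * p.1.factorial)) *
        ∑ q ∈ antidiagonal N, (N.choose q.1 : ℝ) *
      (poch (γ + 1) q.1 * poch S q.1 * poch (β + 1 + q.1) q.2 *
        poch (α + R + 1) q.2 * wellPoisedWeight (β + γ + 1) q.1 q.2 *
        (poch (-(q.1 : ℝ)) p.1 * poch (q.1 + β + γ + 1) p.1)) =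
      R.factorial / (N + R).factorial * ((N.choose p.1 : ℝ) * (poch (-(j : ℝ)) p.1 *
        poch (j + α + γ + 1) p.1 * poch (R + α + γ + 2 + p.1) p.2 *
        poch (R + α + γ + 2 - -(j : ℝ) - (j + α + γ + 1)) p.2)) := by
    rintro ⟨i, M⟩ hp
    obtain rfl := HasAntidiagonal.mem_antidiagonal.mp hp
    simp only
    rw [sum_connection_inner hβ hγ α (by linarith), factorial_div_mul_choose,
      show (R : ℝ) + α + γ + 2 - -(j : ℝ) - (j + α + γ + 1) = R + 1 by ring, ← hS]
    have h1 := poch_neg_natCast_mul (R + M) i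
    rw [show R + M + i = i + M + R by ring, ← poch_natCast_add_one] at h1
    have h2 : poch (-((i + M + R : ℕ) : ℝ)) i ≠ 0 := poch_neg_natCast_ne_zero (by omega)
    have h3 := (poch_pos (a := γ + 1) (by linarith) i).ne'
    have h4 : poch S i ≠ 0 := (poch_degree_pos hα hβ hγ (by omega)).ne'
    have h5 : (i.factorial : ℝ) ≠ 0 := by positivity
    have h6 : ((i + M + R).factorial : ℝ) ≠ 0 := by positivity
    field_simp
    linear_combination (-(poch (-(j : ℝ)) i * poch (j + α + γ + 1) i * ((i + M).choose i) *
      poch (R + α + γ + 2 + i) M)) * h1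
  rw [← Finset.Nat.sum_antidiagonal_eq_sum_range_succ (fun i _ => (poch (-(j : ℝ)) i * poch (j + α + γ + 1) i /
        (poch (-((N + R : ℕ) : ℝ)) i * poch (γ + 1) i * poch S i * i.factorial)) *
        ∑ q ∈ antidiagonal N, (N.choose q.1 : ℝ) *
      (poch (γ + 1) q.1 * poch S q.1 * poch (β + 1 + q.1) q.2 *
        poch (α + R + 1) q.2 * wellPoisedWeight (β + γ + 1) q.1 q.2 *
        (poch (-(q.1 : ℝ)) i * poch (q.1 + β + γ + 1) i))),
    Finset.sum_congr rfl e2, ← Finset.mul_sum, sum_choose_saalschutz]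
  have h1 := poch_neg_natCast_mul_poch R N j
  rw [add_comm R N] at h1
  have h6 : ((N + R).factorial : ℝ) ≠ 0 := by positivity
  rw [show (R : ℝ) + α + γ + 2 - -(j : ℝ) = α + γ + j + 2 + R by ring,
    show (R : ℝ) + α + γ + 2 - (j + α + γ + 1) = R + 1 - j by ring]
  field_simp
  linear_combination (poch (α + γ + j + 2 + R) N) * h1

/-! ### The connection formula on the edge -/

/-- The explicit connection coefficients for the transposition of the first two coordinates. -/
noncomputable def connectionCoeff (α β γ : ℝ) (n j m : ℕ) : ℝ :=
  ((-1 : ℝ) ^ (n + m) *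
    (poch (-(n : ℝ)) j * poch (β + 1) (n - j) * poch (γ + 1) j /
      ((j.factorial : ℝ) * poch (β + 1) m)) *
    (poch ((n : ℝ) + (α + β + γ) + 2) m /
      (poch (β + γ + 2 * (m : ℝ) + 2) (n - m) * poch (β + γ + (m : ℝ) + 1) m))) *
  hyp4F3 (-(m : ℝ)) ((m : ℝ) + β + γ + 1) (-(j : ℝ)) ((j : ℝ) + α + γ + 1)
    (-(n : ℝ)) (γ + 1) ((n : ℝ) + (α + β + γ) + 2) 1

/-- Only the term `k = 0` survives; the constant is `P_n^{(a,b)}(1)`. -/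
theorem homJacobi_self (n : ℕ) {a : ℝ} (ha : -1 < a) (b s : ℝ) :
    homJacobi n a b s s = poch (a + 1) n / n.factorial * s ^ n := by
  have h := jacobiCoeff_eq ha b 0 n
  simp only [zero_add, Nat.choose_zero_right, poch_zero] at h
  rw [homJacobi, Finset.sum_eq_single 0]
  · rw [h]; simp
  · intro k _ hk; simp [hk]
  · simp

theorem choose_div_factorial (k r : ℕ) :
    ((k + r).choose k : ℝ) = (k + r).factorial / (k.factorial * r.factorial) := by
  have h := factorial_div_mul_choose k r
  have : (k.factorial : ℝ) ≠ 0 := by positivity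
  have : (r.factorial : ℝ) ≠ 0 := by positivity
  field_simp at h ⊢
  linear_combination -h

theorem jacobi_bernstein' {a : ℝ} (ha : -1 < a) (b : ℝ) (n : ℕ) (t : ℝ) :
    jacobi n a b (2 * t - 1) = ∑ p ∈ antidiagonal n, (-1) ^ p.1 * poch (a + p.1 + 1) p.2 *
        poch (b + p.2 + 1) p.1 / (p.1.factorial * p.2.factorial) * (1 - t) ^ p.1 * t ^ p.2 := by
  rw [jacobi_bernstein ha, Finset.mul_sum]
  refine Finset.sum_congr rfl fun p hp => ?_
  obtain rfl := HasAntidiagonal.mem_antidiagonal.mp hp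
  have : ((p.1 + p.2).factorial : ℝ) ≠ 0 := by positivity
  rw [choose_div_factorial]
  field_simp

/-- Equality of the coefficients of `(1 - t) ^ N * t ^ R` in `jacobi_edge`. Once the factors
independent of `m` are taken out, it is `sum_connection`. -/
theorem sum_connectionCoeff {α β γ : ℝ} (hα : -1 < α) (hβ : -1 < β) (hγ : -1 < γ) {N R j : ℕ}
    (hj : j ≤ N + R) :
    ∑ p ∈ antidiagonal N, connectionCoeff α β γ (N + R) j p.1 * (poch (γ + 1) p.1 / p.1.factorial) *
      ((-1) ^ p.2 * poch (β + γ + 2 * p.1 + 1 + p.2 + 1) R * poch (α + R + 1) p.2 /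
        (p.2.factorial * R.factorial)) =
      (-1) ^ R * (poch (γ + 1) j / j.factorial) *
        (poch (-(R : ℝ)) j * poch (α + γ + j + 2 + R) N * poch (β + N + 1) (R - j)) /
          (R.factorial * N.factorial) := by
  have hβ' : ∀ k, 0 < poch (β + 1) k := poch_pos (by linarith)
  have key : ∀ p ∈ antidiagonal N,
      connectionCoeff α β γ (N + R) j p.1 * (poch (γ + 1) p.1 / p.1.factorial) *
      ((-1) ^ p.2 * poch (β + γ + 2 * p.1 + 1 + p.2 + 1) R * poch (α + R + 1) p.2 /
        (p.2.factorial * R.factorial)) =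
      (-1) ^ R * (poch (γ + 1) j / j.factorial) *
        (poch (β + 1) (N + R - j) / poch (β + 1) N / (R.factorial * N.factorial)) *
        poch (-((N + R : ℕ) : ℝ)) j * ((N.choose p.1 : ℝ) *
      (poch (γ + 1) p.1 * poch ((N + R : ℕ) + (α + β + γ) + 2) p.1 * poch (β + 1 + p.1) p.2 *
        poch (α + R + 1) p.2 * wellPoisedWeight (β + γ + 1) p.1 p.2 *
        hyp4F3 (-(p.1 : ℝ)) (p.1 + β + γ + 1) (-(j : ℝ)) (j + α + γ + 1)
          (-((N + R : ℕ) : ℝ)) (γ + 1) ((N + R : ℕ) + (α + β + γ) + 2) 1)) := by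
    rintro ⟨m, k⟩ hp
    obtain rfl := HasAntidiagonal.mem_antidiagonal.mp hp
    simp only
    have hm : (0 : ℝ) ≤ m := m.cast_nonneg
    have hk : (0 : ℝ) ≤ k := k.cast_nonneg
    have h1 : poch (β + γ + 2 * (m : ℝ) + 2) (m + k + R - m) =
        poch (β + γ + 1 + 2 * m + 1) k * poch (β + γ + 2 * m + 1 + k + 1) R := by
      rw [show m + k + R - m = k + R by omega, poch_add]; ring_nf
    have h2 : wellPoisedWeight (β + γ + 1) m k =
        (poch (β + γ + m + 1) m * poch (β + γ + 1 + 2 * m + 1) k)⁻¹ := by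
      rw [wellPoisedWeight, add_right_comm (β + γ)]
    have h3 : ((-1 : ℝ) ^ (m + k + R + m)) * (-1) ^ k = (-1) ^ R := by
      rw [← pow_add, show m + k + R + m + k = R + ((m + k) + (m + k)) by ring, pow_add _ R,
        Even.neg_one_pow ⟨m + k, rfl⟩, mul_one]
    have h4 := poch_pos (a := β + γ + 2 * m + 1 + k + 1) (by linarith) R
    have h6 := poch_pos (a := β + 1 + m) (by linarith) k
    rw [connectionCoeff, h1, h2, choose_div_factorial, poch_add (β + 1) m k, ← h3]
    have h7 : ((m + k).factorial : ℝ) ≠ 0 := by positivity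
    generalize hyp4F3 _ _ _ _ _ _ _ _ = H
    have c1 := inv_mul_cancel₀ h4.ne'
    have c2 := inv_mul_cancel₀ h6.ne'
    have c3 := inv_mul_cancel₀ h7
    set P := (-1 : ℝ) ^ (m + k + R + m) * (-1) ^ k * poch (-((m + k + R : ℕ) : ℝ)) j *
      poch (β + 1) (m + k + R - j) * poch (γ + 1) j * poch (γ + 1) m * poch (α + R + 1) k *
      poch (((m + k + R : ℕ) : ℝ) + (α + β + γ) + 2) m * H * (j.factorial : ℝ)⁻¹ *
      (m.factorial : ℝ)⁻¹ * (k.factorial : ℝ)⁻¹ * (R.factorial : ℝ)⁻¹ * (poch (β + 1) m)⁻¹ *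
      (poch (β + γ + m + 1) m)⁻¹ * (poch (β + γ + 1 + 2 * m + 1) k)⁻¹ with hP
    simp only [mul_inv, div_eq_mul_inv]
    linear_combination P * c1 - P * ((m + k).factorial : ℝ)⁻¹ * (m + k).factorial * c2 - P * c3
  rw [Finset.sum_congr rfl key, ← Finset.mul_sum, mul_assoc _ (poch (-((N + R : ℕ) : ℝ)) j),
    sum_connection hα hβ hγ]
  rcases lt_or_ge R j with h | h
  · rw [poch_neg_natCast_eq_zero h]; ring
  · have h1 : poch (β + 1) (N + R - j) = poch (β + 1) N * poch (β + N + 1) (R - j) := by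
      rw [Nat.add_sub_assoc h, poch_add, add_right_comm β]
    have := (hβ' N).ne'
    rw [h1]
    field_simp

theorem jacobi_edge {α β γ : ℝ} (hα : -1 < α) (hβ : -1 < β) (hγ : -1 < γ) {n j : ℕ} (hj : j ≤ n)
    (t : ℝ) :
    jacobi (n - j) (α + γ + 2 * (j : ℝ) + 1) β (2 * (1 - t) - 1) *
        (poch (γ + 1) j / j.factorial * t ^ j) =
      ∑ m ∈ range (n + 1), connectionCoeff α β γ n j m *
        (jacobi (n - m) (β + γ + 2 * (m : ℝ) + 1) α (2 * t - 1) *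
          (poch (γ + 1) m / m.factorial * (1 - t) ^ m)) := by
  have hj0 : (0 : ℝ) ≤ j := j.cast_nonneg
  -- The factor `t ^ j` shifts the Bernstein index. The sum may run over the whole antidiagonal
  -- because `(-R)_j` vanishes for `R < j`, and for `R ≥ j` it accounts for the change of
  -- factorials.
  have e1 : jacobi (n - j) (α + γ + 2 * (j : ℝ) + 1) β (2 * (1 - t) - 1) *
        (poch (γ + 1) j / j.factorial * t ^ j) =
      ∑ p ∈ antidiagonal n, (-1) ^ p.1 * (poch (γ + 1) j / j.factorial) *
        (poch (-(p.1 : ℝ)) j * poch (α + γ + j + 2 + p.1) p.2 * poch (β + p.2 + 1) (p.1 - j)) /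
          (p.1.factorial * p.2.factorial) * ((1 - t) ^ p.2 * t ^ p.1) := by
    obtain ⟨M, rfl⟩ := Nat.exists_eq_add_of_le hj
    rw [sum_antidiagonal_shift (fun R N => (-1) ^ R * (poch (γ + 1) j / j.factorial) *
        (poch (-(R : ℝ)) j * poch (α + γ + j + 2 + R) N * poch (β + N + 1) (R - j)) /
          (R.factorial * N.factorial) * ((1 - t) ^ N * t ^ R)), Nat.add_sub_cancel_left,
      jacobi_bernstein' (by linarith), Finset.sum_mul]
    · refine Finset.sum_congr rfl ?_
      rintro ⟨k, r⟩ -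
      simp only
      have h1 := poch_neg_natCast_mul k j
      rw [add_comm k j] at h1
      have h2 : ((-1 : ℝ) ^ j) * (-1) ^ j = 1 := by rw [← mul_pow]; simp
      have h3 : (k.factorial : ℝ) ≠ 0 := by positivity
      have h4 : poch (-((j + k : ℕ) : ℝ)) j = (-1) ^ j * (j + k).factorial / k.factorial := by
        field_simp; linear_combination h1
      have h5 : ((j + k).factorial : ℝ) ≠ 0 := by positivity
      have h6 : poch (α + γ + 2 * (j : ℝ) + 1 + k + 1) r = poch (α + γ + j + 2 + (j + k : ℕ)) r := by
        congr 1; push_cast; ring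
      rw [h4, h6, Nat.add_sub_cancel_left, pow_add, pow_add, sub_sub_cancel]
      generalize (-1 : ℝ) ^ j = e at *
      field_simp
      rw [show e ^ 2 = 1 by linear_combination h2]
      ring
    · intro m k h
      rw [poch_neg_natCast_eq_zero h]; simp
  have e2 : ∑ m ∈ range (n + 1), connectionCoeff α β γ n j m *
        (jacobi (n - m) (β + γ + 2 * (m : ℝ) + 1) α (2 * t - 1) *
          (poch (γ + 1) m / m.factorial * (1 - t) ^ m)) =
      ∑ p ∈ antidiagonal n, ∑ q ∈ antidiagonal p.2,
        connectionCoeff α β γ n j p.1 * (poch (γ + 1) p.1 / p.1.factorial) *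
      ((-1) ^ q.1 * poch (β + γ + 2 * p.1 + 1 + q.1 + 1) q.2 * poch (α + q.2 + 1) q.1 /
        (q.1.factorial * q.2.factorial)) * ((1 - t) ^ (p.1 + q.1) * t ^ q.2) := by
    rw [← Finset.Nat.sum_antidiagonal_eq_sum_range_succ (fun m k => connectionCoeff α β γ n j m *
        (jacobi k (β + γ + 2 * (m : ℝ) + 1) α (2 * t - 1) *
          (poch (γ + 1) m / m.factorial * (1 - t) ^ m)))]
    refine Finset.sum_congr rfl fun p _ => ?_
    have hp0 : (0 : ℝ) ≤ p.1 := p.1.cast_nonneg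
    rw [jacobi_bernstein' (by linarith), Finset.sum_mul, Finset.mul_sum]
    refine Finset.sum_congr rfl fun q _ => ?_
    rw [pow_add]
    ring
  rw [e1, e2, ← sum_antidiagonal_assoc (fun m k R =>
    connectionCoeff α β γ n j m * (poch (γ + 1) m / m.factorial) *
      ((-1) ^ k * poch (β + γ + 2 * m + 1 + k + 1) R * poch (α + R + 1) k /
        (k.factorial * R.factorial)) * ((1 - t) ^ (m + k) * t ^ R)),
    ← Finset.Nat.sum_antidiagonal_swap]
  refine Finset.sum_congr rfl ?_
  rintro ⟨N, R⟩ hp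
  obtain rfl := HasAntidiagonal.mem_antidiagonal.mp hp
  simp only [Prod.fst_swap, Prod.snd_swap]
  rw [← sum_connectionCoeff hα hβ hγ hj, Finset.sum_mul]
  refine Finset.sum_congr rfl fun q hq => ?_
  rw [HasAntidiagonal.mem_antidiagonal.mp hq]

/-! ### The connection formula on the triangle -/

theorem permAct_swap_zero (y : Fin 3 → ℝ) : permAct (Equiv.swap 0 1) y 0 = y 1 := by
  simp [permAct]

theorem permAct_swap_one (y : Fin 3 → ℝ) : permAct (Equiv.swap 0 1) y 1 = y 0 := by
  simp [permAct]

theorem permAct_swap_two (y : Fin 3 → ℝ) : permAct (Equiv.swap 0 1) y 2 = y 2 := by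
  rw [permAct, Equiv.swap_apply_of_ne_of_ne (by decide) (by decide)]

theorem permTrianglePoly_swap (κ : Fin 3 → ℝ) (n j : ℕ) (x y : ℝ) :
    permTrianglePoly (Equiv.swap 0 1) κ n j x y =
      trianglePoly (permAct (Equiv.swap 0 1) κ) n j y x := by
  rw [permTrianglePoly, permAct_swap_zero, permAct_swap_one]; rfl

theorem permAct_gt {κ : Fin 3 → ℝ} (hκ : ∀ i, -1 < κ i) (τ : Equiv.Perm (Fin 3)) :
    ∀ i, -1 < permAct τ κ i := fun i => hκ (τ i)

/-- The connection formula for the transposition of the first two barycentric coordinates. -/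
theorem trianglePoly_swap_eq_sum {κ : Fin 3 → ℝ} (hκ : ∀ i, -1 < κ i) {n j : ℕ} (hj : j ≤ n)
    (x y : ℝ) :
    trianglePoly (permAct (Equiv.swap 0 1) κ) n j y x =
      ∑ m ∈ range (n + 1), connectionCoeff (κ 0) (κ 1) (κ 2) n j m * trianglePoly κ n m x y := by
  set κ' := permAct (Equiv.swap 0 1) κ with hκ'
  have hκ1 : ∀ i, -1 < κ' i := permAct_gt hκ _
  set A : ℝ × ℝ → ℝ := fun p => trianglePoly κ' n j p.2 p.1 with hA
  set B : ℝ × ℝ → ℝ := fun p => ∑ m ∈ range (n + 1),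
    connectionCoeff (κ 0) (κ 1) (κ 2) n j m * trianglePoly κ n m p.1 p.2 with hB
  have hAm : A ∈ polyDegLT (n + 1) := comp_swap_mem_polyDegLT (trianglePoly_mem_polyDegLT κ' hj)
  have hBm : B ∈ polyDegLT (n + 1) := by
    have : B = ∑ m ∈ range (n + 1), connectionCoeff (κ 0) (κ 1) (κ 2) n j m •
        fun p : ℝ × ℝ => trianglePoly κ n m p.1 p.2 := by
      funext p; simp [hB]
    rw [this]
    refine Submodule.sum_mem _ fun m hm => Submodule.smul_mem _ _ (trianglePoly_mem_polyDegLT κ ?_)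
    exact Nat.lt_succ_iff.mp (mem_range.mp hm)
  -- It remains to check orthogonality to lower degrees, where the swapped side is treated by
  -- exchanging coordinates in the integral, and equality on the edge.
  have h := eq_zero_of_orthogonal_of_edge hκ (Submodule.sub_mem _ hAm hBm) ?_ ?_
  · exact sub_eq_zero.mp (congrFun h (x, y))
  · intro a b hab
    have h1 : triangleIntegral κ (fun p => A p * (p.1 ^ a * p.2 ^ b)) = 0 := by
      have := triangleIntegral_swap κ (fun p => trianglePoly κ' n j p.1 p.2 * (p.1 ^ b * p.2 ^ a))
      rw [triangleIntegral_trianglePoly_mul_monomial hκ1 hj (by omega)] at this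
      rw [this]
      congr 1
      funext p
      simp only [hA, Prod.fst_swap, Prod.snd_swap]
      ring
    have h2 : triangleIntegral κ (fun p => B p * (p.1 ^ a * p.2 ^ b)) = 0 := by
      simp only [hB, Finset.sum_mul, mul_assoc]
      rw [triangleIntegral_sum hκ _ _
        (F := fun m p => trianglePoly κ n m p.1 p.2 * (p.1 ^ a * p.2 ^ b))
        (fun m => (continuous_trianglePoly κ n m).mul (by fun_prop))]
      refine Finset.sum_eq_zero fun m hm => ?_
      rw [triangleIntegral_trianglePoly_mul_monomial hκ (Nat.lt_succ_iff.mp (mem_range.mp hm)) hab,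
        mul_zero]
    have h3 := triangleIntegral_add hκ (F := fun p => A p * (p.1 ^ a * p.2 ^ b))
      (G := fun p => -1 * (B p * (p.1 ^ a * p.2 ^ b)))
      ((continuous_of_mem_polyDegLT hAm).mul (by fun_prop))
      (continuous_const.mul ((continuous_of_mem_polyDegLT hBm).mul (by fun_prop)))
    rw [triangleIntegral_const_mul, h1, h2, mul_zero, add_zero] at h3
    rw [← h3]
    congr 1
    funext p
    simp only [Pi.sub_apply]
    ring
  · intro t
    have h1 := jacobi_edge (hκ 0) (hκ 1) (hκ 2) hj t
    simp only [Pi.sub_apply, hA, hB, trianglePoly]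
    rw [sub_sub_cancel, homJacobi_self j (hκ1 2), hκ', permAct_swap_zero, permAct_swap_one,
      permAct_swap_two, h1, sub_eq_zero]
    refine Finset.sum_congr rfl fun m _ => ?_
    rw [homJacobi_self m (hκ 2)]

/-! ### Norms, connection factors and the Racah weight -/

/-- The Racah weight for the connection coefficients, up to a factor independent of `m`. -/
noncomputable def reducedWeight (α β γ : ℝ) (m k : ℕ) : ℝ :=
  poch (α + 1) k * poch ((m + k : ℕ) + (α + β + γ) + 2) m * poch (γ + 1) m *
    (k.factorial * m.factorial * poch (β + 1) m *
      (poch (β + γ + m + 1) m * poch (β + γ + 2 * m + 2) k))⁻¹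

theorem poch_two_mul_pos {s : ℝ} (hs : -1 < s) (m : ℕ) : 0 < poch (s + m) m := by
  rcases m with _ | m
  · simp [poch_zero]
  · refine poch_pos ?_ _
    have : (0 : ℝ) ≤ m := m.cast_nonneg
    push_cast; linarith

/-- For `m ≥ 1` the pieces `(s + 1)_{m-1}`, `(s + m)_m`, `s + 2m` and `(s + 2m + 1)_k` are
consecutive stretches of one rising factorial. No division by `s` occurs, so `s = 0` is covered. -/
theorem racahFactor_mul (s : ℝ) (m k : ℕ) :
    racahFactor s m * (poch (s + m) m * poch (s + 2 * m + 1) k) = poch (s + 1) (m + k + m) := by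
  rcases m with _ | m
  · simp [racahFactor, poch_zero]
  · have h : poch (s + 1) (m + 1 + k + (m + 1)) =
        poch (s + 1) m * (poch (s + (m + 1 : ℕ)) (m + 1) *
          ((s + 2 * ((m + 1 : ℕ) : ℝ)) * poch (s + 2 * ((m + 1 : ℕ) : ℝ) + 1) k)) := by
      rw [show m + 1 + k + (m + 1) = m + ((m + 1) + (k + 1)) by ring, poch_add _ m,
        poch_add _ (m + 1), poch_succ_left _ k]
      push_cast
      ring_nf
    rw [h, racahFactor]
    push_cast
    ring

/-- With `n = m + k`, reversal of `(-α - n)_m` in the denominator gives a sign `(-1) ^ m` that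
cancels the sign of `(-n)_m` in the numerator. -/
theorem racahWeight_eq_reducedWeight {α β γ : ℝ} (hα : -1 < α) (hβ : -1 < β) (hγ : -1 < γ)
    (m k : ℕ) :
    racahWeight m (-((m + k : ℕ) : ℝ) - 1) ((m + k : ℕ) + α + γ + 1) γ β =
      poch (β + γ + 2) (m + k) * (m + k).factorial / poch (α + 1) (m + k) *
        reducedWeight α β γ m k := by
  have hm : (0 : ℝ) ≤ m := m.cast_nonneg
  have hk : (0 : ℝ) ≤ k := k.cast_nonneg
  have h1 := poch_neg_natCast_mul k m
  have h2 := poch_neg (α + k) m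
  have h3 := poch_add (α + 1) k m
  have h4 := racahFactor_mul (β + γ + 1) m k
  rw [poch_add _ (m + k)] at h4
  rw [add_comm k m] at h1 h3
  have e1 : γ - ((m + k : ℕ) + α + γ + 1) + 1 = -(α + k) - m := by push_cast; ring
  have e2 : γ + β - (-((m + k : ℕ) : ℝ) - 1) + 1 = β + γ + 1 + 1 + (m + k : ℕ) := by ring
  have e3 : ((m + k : ℕ) : ℝ) + α + γ + 1 + β + 1 = (m + k : ℕ) + (α + β + γ) + 2 := by ring
  have e4 : α + k + 1 = α + 1 + k := by ring
  have p1 := poch_pos (a := α + 1) (by linarith) k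
  have p2 := poch_pos (a := α + 1 + k) (by linarith) m
  have p3 := poch_pos (a := β + 1) (by linarith) m
  have p4 := poch_two_mul_pos (s := β + γ + 1) (by linarith) m
  have p5 := poch_pos (a := β + γ + 1 + 2 * m + 1) (by linarith) k
  have p6 := poch_pos (a := β + γ + 1 + 1 + (m + k : ℕ)) (by push_cast; linarith) m
  have p7 : (m.factorial : ℝ) ≠ 0 := by positivity
  have p8 : (k.factorial : ℝ) ≠ 0 := by positivity
  rw [racahWeight, e1, h2, e2, e3, e4, sub_add_cancel, add_comm γ β, reducedWeight, h3,
    show β + γ + (m : ℝ) + 1 = β + γ + 1 + m by ring,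
    show β + γ + 2 * (m : ℝ) + 2 = β + γ + 1 + 2 * m + 1 by ring,
    show β + γ + 2 = β + γ + 1 + 1 by ring]
  have f1 : racahFactor (β + γ + 1) m = poch (β + γ + 1 + 1) (m + k) *
      poch (β + γ + 1 + 1 + (m + k : ℕ)) m /
        (poch (β + γ + 1 + m) m * poch (β + γ + 1 + 2 * m + 1) k) := by
    rw [eq_div_iff (by positivity), h4]
  have f2 : poch (-((m + k : ℕ) : ℝ)) m = (-1) ^ m * (m + k).factorial / k.factorial := by
    rw [eq_div_iff p8, ← h1]; ring
  rw [f1, f2]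
  have p9 : ((-1 : ℝ) ^ m) ≠ 0 := by simp
  generalize (-1 : ℝ) ^ m = e at *
  field_simp

/-- The factor of `triangleNormSq` that is independent of the second degree index. -/
noncomputable def triangleNormConst (κ : Fin 3 → ℝ) (n : ℕ) : ℝ :=
  triangleConst κ * jacobiMass (κ 1 + κ 2 + 1) (κ 0) * jacobiMass (κ 2) (κ 1) /
    poch (κ 0 + κ 1 + κ 2 + 3) (2 * n)

theorem triangleNormConst_pos {κ : Fin 3 → ℝ} (hκ : ∀ i, -1 < κ i) (n : ℕ) :
    0 < triangleNormConst κ n := by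
  have h1 := triangleConst_pos hκ
  have h2 := jacobiMass_pos (a := κ 1 + κ 2 + 1) (by linarith [hκ 1, hκ 2]) (hκ 0)
  have h3 := jacobiMass_pos (hκ 2) (hκ 1)
  have h4 := poch_pos (a := κ 0 + κ 1 + κ 2 + 3) (by linarith [hκ 0, hκ 1, hκ 2]) (2 * n)
  unfold triangleNormConst
  positivity

theorem triangleNormSq_explicit {κ : Fin 3 → ℝ} (hκ : ∀ i, -1 < κ i) (m k : ℕ) :
    triangleNormSq κ (m + k) m = triangleNormConst κ (m + k) *
      (poch ((m + k : ℕ) + (κ 0 + κ 1 + κ 2) + 2 + m) k * poch (κ 1 + κ 2 + 2 * m + 2) k *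
        poch (κ 0 + 1) k * poch (κ 2 + 1) m * poch (κ 1 + 1) m * poch (κ 1 + κ 2 + m + 1) m /
        (k.factorial * m.factorial)) := by
  have hm : (0 : ℝ) ≤ m := m.cast_nonneg
  have h1 := jacobiMass_add_nat (a := κ 1 + κ 2 + 1) (by linarith [hκ 1, hκ 2]) (hκ 0) (2 * m) 0
  rw [show κ 1 + κ 2 + 1 + ((2 * m : ℕ) : ℝ) = κ 1 + κ 2 + 2 * m + 1 by push_cast; ring,
    Nat.cast_zero, add_zero, poch_zero, mul_one, add_zero,
    show κ 1 + κ 2 + 1 + κ 0 + 2 = κ 0 + κ 1 + κ 2 + 3 by ring,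
    show κ 1 + κ 2 + 1 + 1 = κ 1 + κ 2 + 2 by ring] at h1
  have h2 : poch (κ 0 + κ 1 + κ 2 + 3) (2 * (m + k)) = poch (κ 0 + κ 1 + κ 2 + 3) (2 * m) *
      poch (κ 1 + κ 2 + 2 * m + 1 + κ 0 + 2) (2 * k) := by
    rw [mul_add, poch_add]; push_cast; ring_nf
  have p1 := poch_pos (a := κ 0 + κ 1 + κ 2 + 3) (by linarith [hκ 0, hκ 1, hκ 2]) (2 * m)
  have p2 := poch_pos (a := κ 1 + κ 2 + 2 * m + 1 + κ 0 + 2) (by linarith [hκ 0, hκ 1, hκ 2]) (2 * k)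
  have p3 := poch_pos (a := κ 1 + κ 2 + 2) (by linarith [hκ 1, hκ 2]) (2 * m)
  have p4 : (m.factorial : ℝ) ≠ 0 := by positivity
  have p5 : (k.factorial : ℝ) ≠ 0 := by positivity
  rw [triangleNormSq_eq, triangleIntegral_trianglePoly_sq hκ, Nat.add_sub_cancel_left,
    jacobiNormSq, jacobiNormSq, h1, triangleNormConst, h2,
    show (k : ℝ) + (κ 1 + κ 2 + 2 * m + 1) + κ 0 + 1 =
      (m + k : ℕ) + (κ 0 + κ 1 + κ 2) + 2 + m by push_cast; ring,
    show κ 1 + κ 2 + 2 * (m : ℝ) + 1 + 1 = κ 1 + κ 2 + 2 * m + 2 by ring,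
    show (m : ℝ) + κ 2 + κ 1 + 1 = κ 1 + κ 2 + m + 1 by ring,
    show κ 2 + κ 1 + 2 = κ 1 + κ 2 + 2 by ring]
  field_simp

/-- The factor of `connectionCoeff` that depends on `m` only. -/
noncomputable def connectionColFactor (α β γ : ℝ) (n m : ℕ) : ℝ :=
  poch ((n : ℝ) + (α + β + γ) + 2) m *
    (poch (β + 1) m * (poch (β + γ + 2 * m + 2) (n - m) * poch (β + γ + m + 1) m))⁻¹

/-- The absolute value of the factor of `connectionCoeff` that depends on `j` only. -/
noncomputable def connectionRowFactor (β γ : ℝ) (n j : ℕ) : ℝ :=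
  n.factorial / (n - j).factorial * poch (β + 1) (n - j) * poch (γ + 1) j / j.factorial

theorem connectionColFactor_pos {α β γ : ℝ} (hα : -1 < α) (hβ : -1 < β) (hγ : -1 < γ) {n m : ℕ}
    (h : m ≤ n) : 0 < connectionColFactor α β γ n m := by
  have hm : (0 : ℝ) ≤ m := m.cast_nonneg
  have h2 := poch_degree_pos hα hβ hγ h
  have h4 := poch_pos (a := β + 1) (by linarith) m
  have h5 := poch_two_mul_pos (s := β + γ + 1) (by linarith) m
  have h6 := poch_pos (a := β + γ + 2 * m + 2) (by linarith) (n - m)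
  rw [add_right_comm] at h5
  unfold connectionColFactor
  positivity

theorem connectionRowFactor_pos {β γ : ℝ} (hβ : -1 < β) (hγ : -1 < γ) (n j : ℕ) :
    0 < connectionRowFactor β γ n j := by
  have h3 := poch_pos (a := γ + 1) (by linarith) j
  have h4 := poch_pos (a := β + 1) (by linarith) (n - j)
  unfold connectionRowFactor
  positivity

theorem hyp4F3_comm (a b c d e f g z : ℝ) :
    hyp4F3 a b c d e f g z = hyp4F3 c d a b e g f z := by
  unfold hyp4F3
  congr 1
  funext k
  ring

/-- The `₄F₃` is unchanged when the upper pairs belonging to `m` and `j` trade places, so it can be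
read as the Racah polynomial of degree `j` at the lattice point `m`. The extra sign `(-1) ^ j` comes
from `(-n)_j`. -/
theorem connectionCoeff_eq_racah (α β γ : ℝ) {n j : ℕ} (hj : j ≤ n) (m : ℕ) :
    connectionCoeff α β γ n j m = (-1) ^ (n + m + j) * connectionRowFactor β γ n j *
      connectionColFactor α β γ n m * (racahPoly j (-(n : ℝ) - 1) (n + α + γ + 1) γ β).eval
        (m * (m + β + γ + 1)) := by
  have h1 : (m : ℝ) * (m + β + γ + 1) = racahLambda γ β m := by rw [racahLambda]; ring
  obtain ⟨r, rfl⟩ := Nat.exists_eq_add_of_le' hj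
  have h2 := poch_neg_natCast_mul r j
  have p8 : (r.factorial : ℝ) ≠ 0 := by positivity
  have h3 : poch (-((r + j : ℕ) : ℝ)) j = (-1) ^ j * ((r + j).factorial / r.factorial) := by
    rw [← mul_div_assoc, eq_div_iff p8, ← h2]; ring
  rw [h1, racahPoly_eval, connectionCoeff, hyp4F3_comm, connectionRowFactor, connectionColFactor, h3,
    Nat.add_sub_cancel, show (j : ℝ) + (-((r + j : ℕ) : ℝ) - 1) + ((r + j : ℕ) + α + γ + 1) + 1 =
      j + α + γ + 1 by ring, show (m : ℝ) + γ + β + 1 = m + β + γ + 1 by ring, sub_add_cancel,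
    show ((r + j : ℕ) : ℝ) + α + γ + 1 + β + 1 = (r + j : ℕ) + (α + β + γ) + 2 by ring, pow_add _ _ j]
  simp only [div_eq_mul_inv, mul_inv]
  ring

/-- The constant relating the norms on the triangle to the Racah weight. -/
noncomputable def racahNormConst (κ : Fin 3 → ℝ) (n : ℕ) : ℝ :=
  triangleNormConst κ n * poch (n + (κ 0 + κ 1 + κ 2) + 2) n * poch (κ 0 + 1) n /
    (poch (κ 1 + κ 2 + 2) n * n.factorial)

theorem racahNormConst_pos {κ : Fin 3 → ℝ} (hκ : ∀ i, -1 < κ i) (n : ℕ) :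
    0 < racahNormConst κ n := by
  have h1 := triangleNormConst_pos hκ n
  have h2 := poch_degree_pos (hκ 0) (hκ 1) (hκ 2) (le_refl n)
  have h3 := poch_pos (a := κ 0 + 1) (by linarith [hκ 0]) n
  have h4 := poch_pos (a := κ 1 + κ 2 + 2) (by linarith [hκ 1, hκ 2]) n
  unfold racahNormConst
  positivity

/-- This is where the Racah weight enters: the dependence on `m` of the squared norm and of the
squared column factor combine to exactly that weight. -/
theorem triangleNormSq_mul_sq {κ : Fin 3 → ℝ} (hκ : ∀ i, -1 < κ i) {n m : ℕ} (h : m ≤ n) :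
    triangleNormSq κ n m * connectionColFactor (κ 0) (κ 1) (κ 2) n m ^ 2 =
      racahNormConst κ n *
        racahWeight m (-(n : ℝ) - 1) (n + κ 0 + κ 2 + 1) (κ 2) (κ 1) := by
  obtain ⟨k, rfl⟩ := Nat.exists_eq_add_of_le h
  have hm : (0 : ℝ) ≤ m := m.cast_nonneg
  rw [racahWeight_eq_reducedWeight (hκ 0) (hκ 1) (hκ 2), triangleNormSq_explicit hκ,
    racahNormConst, connectionColFactor, reducedWeight, poch_add (((m + k : ℕ) : ℝ) + _ + 2) m k,
    Nat.add_sub_cancel_left]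
  have p1 := (poch_pos (a := κ 0 + 1) (by linarith [hκ 0]) (m + k)).ne'
  have p2 := (poch_pos (a := κ 1 + κ 2 + 2) (by linarith [hκ 1, hκ 2]) (m + k)).ne'
  have p3 := (poch_pos (a := κ 1 + 1) (by linarith [hκ 1]) m).ne'
  have p4 := (poch_two_mul_pos (s := κ 1 + κ 2 + 1) (by linarith [hκ 1, hκ 2]) m).ne'
  have p5 := (poch_pos (a := κ 1 + κ 2 + 2 * m + 2) (by linarith [hκ 1, hκ 2]) k).ne'
  rw [add_right_comm (κ 1 + κ 2)] at p4
  have p6 : (m.factorial : ℝ) ≠ 0 := by positivity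
  have p7 : (k.factorial : ℝ) ≠ 0 := by positivity
  have p8 : ((m + k).factorial : ℝ) ≠ 0 := by positivity
  generalize poch (κ 0 + 1) (m + k) = x1 at *
  generalize poch (κ 1 + κ 2 + 2) (m + k) = x2 at *
  generalize poch (κ 1 + 1) m = x3 at *
  generalize poch (κ 1 + κ 2 + m + 1) m = x4 at *
  generalize poch (κ 1 + κ 2 + 2 * m + 2) k = x5 at *
  field_simp

/-! ### The connection matrix: uniqueness, Parseval, symmetry -/

/-- The inner product of `P_m^κ` with the `j`-th polynomial of the transposed basis. -/
noncomputable def swapInner (κ : Fin 3 → ℝ) (n j m : ℕ) : ℝ :=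
  triangleIntegral κ (fun p => trianglePoly (permAct (Equiv.swap 0 1) κ) n j p.2 p.1 *
    trianglePoly κ n m p.1 p.2)

theorem permAct_swap_swap (κ : Fin 3 → ℝ) :
    permAct (Equiv.swap 0 1) (permAct (Equiv.swap 0 1) κ) = κ := by
  funext i
  simp [permAct]

theorem swapInner_comm (κ : Fin 3 → ℝ) (n j m : ℕ) :
    swapInner (permAct (Equiv.swap 0 1) κ) n m j = swapInner κ n j m := by
  rw [swapInner, triangleIntegral_swap, swapInner, permAct_swap_swap]
  congr 1
  funext p
  simp only [Prod.fst_swap, Prod.snd_swap]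
  ring

theorem triangleConst_swap (κ : Fin 3 → ℝ) :
    triangleConst (permAct (Equiv.swap 0 1) κ) = triangleConst κ := by
  rw [triangleConst, triangleConst, permAct_swap_zero, permAct_swap_one, permAct_swap_two,
    add_comm (κ 1), mul_comm (Real.Gamma (κ 1 + 1))]

/-- Pair the connection formula with the polynomial of index `m`. Since the right side does not
involve `c`, uniqueness follows; its symmetry gives the duality of the two Racah forms. -/
theorem mul_triangleNormSq_of_isConnectionMatrix {κ : Fin 3 → ℝ} (hκ : ∀ i, -1 < κ i) {n : ℕ}
    {c : Matrix (Fin (n + 1)) (Fin (n + 1)) ℝ} (hc : IsConnectionMatrix (Equiv.swap 0 1) κ n c)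
    (j m : Fin (n + 1)) :
    c j m * triangleNormSq κ n m = triangleConst κ * swapInner κ n j m := by
  have h : ∀ p : ℝ × ℝ, trianglePoly (permAct (Equiv.swap 0 1) κ) n j p.2 p.1 *
      trianglePoly κ n m p.1 p.2 =
        ∑ i, c j i * (trianglePoly κ n i p.1 p.2 * trianglePoly κ n m p.1 p.2) := by
    intro p
    rw [← permTrianglePoly_swap, hc j, Finset.sum_mul]
    simp only [mul_assoc]
  rw [swapInner]
  simp_rw [h]
  rw [triangleIntegral_sum hκ _ _
    (F := fun (i : Fin (n + 1)) p => trianglePoly κ n i p.1 p.2 * trianglePoly κ n m p.1 p.2)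
    (fun i => (continuous_trianglePoly κ n i).mul (continuous_trianglePoly κ n m)),
    Finset.sum_eq_single m]
  · rw [triangleNormSq_eq]; ring
  · intro i _ hi
    rw [triangleIntegral_trianglePoly_of_ne hκ (fun h => hi (Fin.ext h)), mul_zero]
  · simp

/-- Parseval's identity for the transposed polynomial in the orthogonal basis. -/
theorem sum_sq_mul_triangleNormSq {κ : Fin 3 → ℝ} (hκ : ∀ i, -1 < κ i) {n : ℕ}
    {c : Matrix (Fin (n + 1)) (Fin (n + 1)) ℝ} (hc : IsConnectionMatrix (Equiv.swap 0 1) κ n c)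
    (j : Fin (n + 1)) :
    ∑ m, c j m ^ 2 * triangleNormSq κ n m =
      triangleNormSq (permAct (Equiv.swap 0 1) κ) n j := by
  set κ' := permAct (Equiv.swap 0 1) κ with hκ'
  have h1 : ∀ m, c j m ^ 2 * triangleNormSq κ n m =
      triangleConst κ * (c j m * swapInner κ n j m) := by
    intro m
    have := mul_triangleNormSq_of_isConnectionMatrix hκ hc j m
    linear_combination c j m * this
  simp_rw [h1]
  rw [← Finset.mul_sum, triangleNormSq_eq, hκ', triangleConst_swap, triangleIntegral_swap, ← hκ']
  congr 1
  have h : ∀ p : ℝ × ℝ, trianglePoly κ' n j p.2 p.1 * trianglePoly κ' n j p.2 p.1 =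
        ∑ i, c j i * (trianglePoly κ' n j p.2 p.1 * trianglePoly κ n i p.1 p.2) := by
    intro p
    conv_lhs => enter [2]; rw [hκ', ← permTrianglePoly_swap, hc j]
    rw [Finset.mul_sum]
    exact Finset.sum_congr rfl fun i _ => by ring
  simp only [Prod.fst_swap, Prod.snd_swap]
  simp_rw [h]
  rw [triangleIntegral_sum hκ _ _
    (F := fun (i : Fin (n + 1)) p => trianglePoly κ' n j p.2 p.1 * trianglePoly κ n i p.1 p.2)
    (fun i => ((continuous_trianglePoly κ' n j).comp continuous_swap).mul
      (continuous_trianglePoly κ n i))]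
  rfl

/-- The matrix of connection coefficients for the transposition `(12)`. -/
noncomputable def connectionMatrix (κ : Fin 3 → ℝ) (n : ℕ) : Matrix (Fin (n + 1)) (Fin (n + 1)) ℝ :=
  fun j m => connectionCoeff (κ 0) (κ 1) (κ 2) n j m

theorem isConnectionMatrix_connectionMatrix {κ : Fin 3 → ℝ} (hκ : ∀ i, -1 < κ i) (n : ℕ) :
    IsConnectionMatrix (Equiv.swap 0 1) κ n (connectionMatrix κ n) := by
  intro j x y
  rw [permTrianglePoly_swap, trianglePoly_swap_eq_sum hκ (Nat.lt_succ_iff.mp j.2),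
    Finset.sum_range]
  rfl

theorem isConnectionMatrix_iff {κ : Fin 3 → ℝ} (hκ : ∀ i, -1 < κ i) (n : ℕ)
    (c : Matrix (Fin (n + 1)) (Fin (n + 1)) ℝ) :
    IsConnectionMatrix (Equiv.swap 0 1) κ n c ↔ c = connectionMatrix κ n := by
  refine ⟨fun hc => ?_, fun h => h ▸ isConnectionMatrix_connectionMatrix hκ n⟩
  ext j m
  apply mul_right_cancel₀ (triangleNormSq_pos hκ n m).ne'
  rw [mul_triangleNormSq_of_isConnectionMatrix hκ hc,
    mul_triangleNormSq_of_isConnectionMatrix hκ (isConnectionMatrix_connectionMatrix hκ n)]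

/-- Each side is a common constant times `swapInner`, divided by the geometric mean of the two
squared norms, and `swapInner` is symmetric. -/
theorem normalizedConnection_comm {κ : Fin 3 → ℝ} (hκ : ∀ i, -1 < κ i) (n : ℕ)
    (j m : Fin (n + 1)) :
    normalizedConnection (Equiv.swap 0 1) κ n (connectionMatrix κ n) j m =
      normalizedConnection (Equiv.swap 0 1) (permAct (Equiv.swap 0 1) κ) n
        (connectionMatrix (permAct (Equiv.swap 0 1) κ) n) m j := by
  have hκ' := permAct_gt hκ (Equiv.swap 0 1)
  have h1 := mul_triangleNormSq_of_isConnectionMatrix hκ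
    (isConnectionMatrix_connectionMatrix hκ n) j m
  have h2 := mul_triangleNormSq_of_isConnectionMatrix hκ'
    (isConnectionMatrix_connectionMatrix hκ' n) m j
  rw [triangleConst_swap, swapInner_comm, ← h1] at h2
  have ha := triangleNormSq_pos hκ n m
  have hb := triangleNormSq_pos hκ' n j
  rw [normalizedConnection, normalizedConnection, permAct_swap_swap]
  generalize triangleNormSq κ n m = a at *
  generalize triangleNormSq (permAct (Equiv.swap 0 1) κ) n j = b at *
  have h3 : Real.sqrt (a / b) * b = Real.sqrt (b / a) * a := by
    rw [Real.sqrt_div ha.le, Real.sqrt_div hb.le]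
    have sa := Real.sqrt_pos.mpr ha
    have sb := Real.sqrt_pos.mpr hb
    have ea := Real.mul_self_sqrt ha.le
    have eb := Real.mul_self_sqrt hb.le
    field_simp
    linear_combination b * ea - a * eb
  apply mul_right_cancel₀ (mul_pos ha hb).ne'
  linear_combination (connectionMatrix κ n j m * a) * h3 - (Real.sqrt (b / a) * a) * h2

theorem normalizedConnection_eq_racah {κ : Fin 3 → ℝ} (hκ : ∀ i, -1 < κ i) (n : ℕ)
    (j m : Fin (n + 1)) :
    normalizedConnection (Equiv.swap 0 1) κ n (connectionMatrix κ n) j m =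
      (-1 : ℝ) ^ (n + (m : ℕ) + (j : ℕ)) *
        Real.sqrt (racahWeight m (-(n : ℝ) - 1) ((n : ℝ) + κ 0 + κ 2 + 1) (κ 2) (κ 1)) *
        (racahOrthonormal n j (-(n : ℝ) - 1) ((n : ℝ) + κ 0 + κ 2 + 1) (κ 2) (κ 1)).eval
          ((m : ℝ) * ((m : ℝ) + κ 1 + κ 2 + 1)) := by
  set w : ℕ → ℝ := fun m =>
    racahWeight m (-(n : ℝ) - 1) ((n : ℝ) + κ 0 + κ 2 + 1) (κ 2) (κ 1) with hw
  set R : ℕ → ℝ := fun m => (racahPoly j (-(n : ℝ) - 1) (n + κ 0 + κ 2 + 1) (κ 2) (κ 1)).eval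
        (m * (m + κ 1 + κ 2 + 1)) with hR
  set r := racahNormSq n j (-(n : ℝ) - 1) ((n : ℝ) + κ 0 + κ 2 + 1) (κ 2) (κ 1) with hr
  set f := connectionRowFactor (κ 1) (κ 2) n j with hf
  set G := connectionColFactor (κ 0) (κ 1) (κ 2) n with hG
  set K := racahNormConst κ n with hK
  have hKpos : 0 < K := racahNormConst_pos hκ n
  have hfpos : 0 < f := connectionRowFactor_pos (hκ 1) (hκ 2) n j
  have hB := triangleNormSq_pos (permAct_gt hκ (Equiv.swap 0 1)) n j
  have hc : ∀ m : Fin (n + 1), connectionMatrix κ n j m =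
      (-1) ^ (n + (m : ℕ) + (j : ℕ)) * f * G m * R m := fun m =>
    connectionCoeff_eq_racah _ _ _ (Nat.lt_succ_iff.mp j.2) m
  have hsign : ∀ k : ℕ, ((-1 : ℝ) ^ k) ^ 2 = 1 := fun k => by rw [← pow_mul, mul_comm]; simp
  have hA : ∀ m : Fin (n + 1), triangleNormSq κ n m * G m ^ 2 = K * w m := fun m =>
    triangleNormSq_mul_sq hκ (Nat.lt_succ_iff.mp m.2)
  -- Parseval, with each coefficient written in factored form, becomes the sum defining the Racah
  -- norm `r`.
  have hsum : triangleNormSq (permAct (Equiv.swap 0 1) κ) n j = K * f ^ 2 * r := by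
    rw [← sum_sq_mul_triangleNormSq hκ (isConnectionMatrix_connectionMatrix hκ n) j, hr, racahNormSq,
      Finset.sum_range, Finset.mul_sum]
    refine Finset.sum_congr rfl fun i _ => ?_
    have e : racahLambda (κ 2) (κ 1) ((i : ℕ) : ℝ) = (i : ℕ) * ((i : ℕ) + κ 1 + κ 2 + 1) := by
      rw [racahLambda]; ring
    rw [hc, e]
    linear_combination f ^ 2 * R i ^ 2 * hA i +
      (f * G i * R i) ^ 2 * triangleNormSq κ n i * hsign (n + (i : ℕ) + (j : ℕ))
  -- Positivity of `r` is read off from the positive triangle norm, so the Racah sum need not be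
  -- examined.
  have hrpos : 0 < r := by
    rw [hsum] at hB
    exact pos_of_mul_pos_right hB (by positivity)
  have hratio : triangleNormSq κ n m / triangleNormSq (permAct (Equiv.swap 0 1) κ) n j *
      (f * G m) ^ 2 = w m / r := by
    rw [hsum]
    field_simp
    linear_combination hA m
  have hGpos : 0 < G m := connectionColFactor_pos (hκ 0) (hκ 1) (hκ 2) (Nat.lt_succ_iff.mp m.2)
  have hsqrt : Real.sqrt (triangleNormSq κ n m /
      triangleNormSq (permAct (Equiv.swap 0 1) κ) n j) * (f * G m) =
        Real.sqrt (w m) * (Real.sqrt r)⁻¹ := by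
    rw [← div_eq_mul_inv, ← Real.sqrt_div' _ hrpos.le, ← hratio, Real.sqrt_mul' _ (sq_nonneg _),
      Real.sqrt_sq (by positivity)]
  rw [normalizedConnection, hc, racahOrthonormal, Polynomial.eval_mul, Polynomial.eval_C, ← hr]
  linear_combination ((-1) ^ (n + (m : ℕ) + (j : ℕ)) * R m) * hsqrt

end

/-- The connection coefficients on the triangle for the transposition of the first two barycentric
coordinates: they exist and are unique, are given by an explicit `₄F₃` formula, and after
normalization they are Racah polynomials in two dual ways. -/
theorem mainTheorem4 (κ : Fin 3 → ℝ) (hκ : ∀ i, -1 < κ i) (n : ℕ) :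
    ∃ c : Matrix (Fin (n + 1)) (Fin (n + 1)) ℝ,
      (∀ c' : Matrix (Fin (n + 1)) (Fin (n + 1)) ℝ,
        IsConnectionMatrix (Equiv.swap 0 1) κ n c' ↔ c' = c) ∧
      ∀ j m : Fin (n + 1),
        c j m =
          ((-1 : ℝ) ^ (n + (m : ℕ)) *
            (poch (-(n : ℝ)) j * poch (κ 1 + 1) (n - (j : ℕ)) * poch (κ 2 + 1) j /
              (((j : ℕ).factorial : ℝ) * poch (κ 1 + 1) m)) *
            (poch ((n : ℝ) + (κ 0 + κ 1 + κ 2) + 2) m /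
              (poch (κ 1 + κ 2 + 2 * (m : ℝ) + 2) (n - (m : ℕ)) *
                poch (κ 1 + κ 2 + (m : ℝ) + 1) m))) *
          hyp4F3 (-(m : ℝ)) ((m : ℝ) + κ 1 + κ 2 + 1) (-(j : ℝ)) ((j : ℝ) + κ 0 + κ 2 + 1)
            (-(n : ℝ)) (κ 2 + 1) ((n : ℝ) + (κ 0 + κ 1 + κ 2) + 2) 1 ∧
        normalizedConnection (Equiv.swap 0 1) κ n c j m =
          (-1 : ℝ) ^ (n + (m : ℕ) + (j : ℕ)) *
            Real.sqrt (racahWeight m (-(n : ℝ) - 1) ((n : ℝ) + κ 0 + κ 2 + 1) (κ 2) (κ 1)) *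
            (racahOrthonormal n j (-(n : ℝ) - 1) ((n : ℝ) + κ 0 + κ 2 + 1) (κ 2) (κ 1)).eval
              ((m : ℝ) * ((m : ℝ) + κ 1 + κ 2 + 1)) ∧
        normalizedConnection (Equiv.swap 0 1) κ n c j m =
          (-1 : ℝ) ^ (n + (m : ℕ) + (j : ℕ)) *
            Real.sqrt (racahWeight j (-(n : ℝ) - 1) ((n : ℝ) + κ 1 + κ 2 + 1) (κ 2) (κ 0)) *
            (racahOrthonormal n m (-(n : ℝ) - 1) ((n : ℝ) + κ 1 + κ 2 + 1) (κ 2) (κ 0)).eval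
              ((j : ℝ) * ((j : ℝ) + κ 0 + κ 2 + 1)) := by
  refine ⟨connectionMatrix κ n, isConnectionMatrix_iff hκ n, fun j m =>
    ⟨rfl, normalizedConnection_eq_racah hκ n j m, ?_⟩⟩
  -- The second Racah form is the first one for the transposed parameters with `j` and `m`
  -- exchanged; only the order of the summands in the sign exponent has to be adjusted.
  rw [normalizedConnection_comm hκ, normalizedConnection_eq_racah (permAct_gt hκ _),
    permAct_swap_zero, permAct_swap_one, permAct_swap_two, add_right_comm n]
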